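/- For $e\in S^1\subset\mathbb{R}^2$ let $\pi_e$ denote the orthogonal projection of $\mathbb{R}^2$ onto the line $\mathrm{span}(e)$. For a non-empty bounded set $F\subset\mathbb{R}^2$ let $N(F,\delta)$ be the smallest number of sets of diameter at most $\delta$ needed to cover $F$, and let $$\overline{\dim}_B F=\limsup_{\delta\to 0}\frac{\log N(F,\delta)}{-\log\delta}$$ be its upper box dimension. For $t>0$, call a set $E\subset\mathbb{R}^2$ $t$-Ahlfors-David regular if there are a constant $C>0$ and a Borel measure $\mu$ on $E$ (that is, $\mu(\mathbb{R}^2\setminus E)=0$ and $E\subseteq\operatorname{spt}\mu$, so that $\operatorname{spt}\mu=\overline{E}$) such that $$C^{-1}r^t\le\mu(B(x,r))\le C\,r^t\qquad\text{for all }x\in\operatorname{spt}\mu\text{ and all }0<r\le\operatorname{diam}(\operatorname{spt}\mu),$$ where $B(x,r)$ is the closed ball. **Theorem.** There exists a countable set $\Omega\subset S^1$ such that for every $t\in(0,2]$ and every $t$-Ahlfors-David regular set $E\subset[0,1)^2$ with at least two points, $$\sup_{e\in\Omega}\overline{\dim}_B\,\pi_e(E)=\min\{t,1\}.$$ -/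

import Mathlib

noncomputable section

/-- A Borel measure `μ` is `(t, C)`-Ahlfors-David regular if `r ^ t / C ≤ μ (B(x, r)) ≤ C * r ^ t`
for all `x` in the support of `μ` and all `0 < r ≤ diam (spt μ)`. The diameter is taken in
`[0, ∞]`, so that it is `∞` when the support is unbounded. -/
def IsADRegularMeasure {X : Type*} [PseudoMetricSpace X] [MeasurableSpace X] [BorelSpace X]
    (t C : ℝ) (μ : MeasureTheory.Measure X) : Prop :=
  ∀ x ∈ μ.support, ∀ r : ℝ, 0 < r → ENNReal.ofReal r ≤ Metric.ediam μ.support →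
    ENNReal.ofReal (r ^ t / C) ≤ μ (Metric.closedBall x r) ∧
      μ (Metric.closedBall x r) ≤ ENNReal.ofReal (C * r ^ t)

/-- A set `E` is `(t, C)`-Ahlfors-David regular if it carries a `(t, C)`-Ahlfors-David regular
measure `μ`: the measure `μ` gives no mass to the complement of `E`, and every point of `E` is in
the support of `μ` (so that `spt μ` is the closure of `E`). The set `E` need not be closed. -/
def IsADRegularSetWith {X : Type*} [PseudoMetricSpace X] [MeasurableSpace X] [BorelSpace X]
    (t C : ℝ) (E : Set X) : Prop :=
  ∃ μ : MeasureTheory.Measure X, μ Eᶜ = 0 ∧ E ⊆ μ.support ∧ IsADRegularMeasure t C μ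

/-- A set is `t`-Ahlfors-David regular if it is `(t, C)`-Ahlfors-David regular for some `C > 0`. -/
def IsADRegularSet {X : Type*} [PseudoMetricSpace X] [MeasurableSpace X] [BorelSpace X]
    (t : ℝ) (E : Set X) : Prop :=
  ∃ C : ℝ, 0 < C ∧ IsADRegularSetWith t C E

/-- `boxCount F δ` is the smallest number of sets of diameter at most `δ` that cover `F`
(used for bounded subsets `F` of a Euclidean space and `δ > 0`, where such a number exists). -/
def boxCount {X : Type*} [PseudoMetricSpace X] (F : Set X) (δ : ℝ) : ℕ :=
  sInf {k : ℕ | ∃ U : Fin k → Set X,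
    F ⊆ ⋃ i, U i ∧ ∀ i, Metric.ediam (U i) ≤ ENNReal.ofReal δ}

/-- The upper box dimension of a non-empty bounded set `F`: the limit superior of
`log N(F, δ) / (- log δ)` as `δ → 0+`, taken in the extended reals. -/
def upperBoxDim {X : Type*} [PseudoMetricSpace X] (F : Set X) : EReal :=
  Filter.limsup (fun δ : ℝ => ((Real.log (boxCount F δ) / (-Real.log δ) : ℝ) : EReal))
    (nhdsWithin 0 (Set.Ioi 0))

/-- The orthogonal projection `π_e` of the plane onto the line spanned by `e`. -/
def lineProj (e : EuclideanSpace ℝ (Fin 2)) :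
    EuclideanSpace ℝ (Fin 2) → EuclideanSpace ℝ (Fin 2) :=
  fun x => (Submodule.span ℝ {e}).starProjection x

end

open MeasureTheory

/-! Take for `Ω` the directions `(1, j / 2 ^ m)`. The upper bound is soft: a projection is
1-Lipschitz, so squares covering `E` give exponent `t`, and the image lies in a bounded segment,
which gives exponent 1.

The lower bound is an entropy argument. Let `ν` be the normalised regular measure, fix `m`, and
measure the entropy of `ν` along strips of width `ρ` of slope `j / 2 ^ m`. A square of side `ρ`
meets at most three such strips, so refining to width `ρ / 2 ^ m` gains at least the conditional
entropy given the squares, minus `log 3` (`sum_mul_log_refine_le`). By concavity of the logarithm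
that conditional entropy is controlled by collision probabilities (`sum_mul_log_div_le`), and these
are small on average over `j` by transversality: two points at distance about `ρ / 2 ^ i` share a
thin strip for only about `2 ^ i` slopes (`card_slopes_le`, `card_same_strip_le`). With the
regularity of `ν` the average gain is at least `min t 1 * m * log 2 - log (m + 1)` up to a constant
independent of `ρ`.

Iterating over the scales `2 ^ (-m n)`, some slope at each `n` has at least the average entropy,
hence many strips. For `σ < min t 1` a large fixed `m` makes the logarithmic loss negligible. Only
finitely many slopes are then in play, so one of them serves infinitely many `n`, which is all that
a limsup needs. -/

/-! ### Entropy inequalities for finite sums -/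

/-- Comparing two weighted sums of measures through the corresponding sums of indicators. -/
theorem sum_mul_measureReal_le_of_indicator_le {X ι κ : Type*} [MeasurableSpace X]
    {ν : Measure X} [IsFiniteMeasure ν] {E : Set X} (hE : ν Eᶜ = 0)
    (S : Finset ι) (T : Finset κ) (a : ι → ℝ) (c : κ → ℝ) (A : ι → Set X) (B : κ → Set X)
    (hA : ∀ i ∈ S, MeasurableSet (A i)) (hB : ∀ k ∈ T, MeasurableSet (B k))
    (h : ∀ x ∈ E, ∑ i ∈ S, (A i).indicator (fun _ => a i) x ≤
      ∑ k ∈ T, (B k).indicator (fun _ => c k) x) :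
    ∑ i ∈ S, a i * ν.real (A i) ≤ ∑ k ∈ T, c k * ν.real (B k) := by
  have hi : ∀ (u : ℝ) (s : Set X), MeasurableSet s →
      Integrable (s.indicator (fun _ => u)) ν := fun u s hs =>
    (integrable_const u).indicator hs
  have hv : ∀ (u : ℝ) (s : Set X), MeasurableSet s →
      ∫ x, s.indicator (fun _ => u) x ∂ν = u * ν.real s := fun u s hs => by
    rw [integral_indicator hs, setIntegral_const, smul_eq_mul, mul_comm]
  calc ∑ i ∈ S, a i * ν.real (A i)
      = ∫ x, ∑ i ∈ S, (A i).indicator (fun _ => a i) x ∂ν := by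
        rw [integral_finsetSum _ (fun i hiS => hi _ _ (hA i hiS))]
        exact Finset.sum_congr rfl fun i hiS => (hv _ _ (hA i hiS)).symm
    _ ≤ ∫ x, ∑ k ∈ T, (B k).indicator (fun _ => c k) x ∂ν := by
        refine integral_mono_ae (integrable_finsetSum _ fun i hiS => hi _ _ (hA i hiS))
          (integrable_finsetSum _ fun i hiS => hi _ _ (hB i hiS)) ?_
        have : ∀ᵐ x ∂ν, x ∈ E := by rwa [ae_iff]
        filter_upwards [this] with x hx using h x hx
    _ = ∑ k ∈ T, c k * ν.real (B k) := by
        rw [integral_finsetSum _ (fun i hiS => hi _ _ (hB i hiS))]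
        exact Finset.sum_congr rfl fun i hiS => hv _ _ (hB i hiS)

/-- The tangent line of the concave function `log` at `a`. It replaces Jensen below: taking `a` to
be the expected mean turns each entropy inequality into a linear sum. -/
theorem log_le_div_add_log_sub_one {x a : ℝ} (hx : 0 < x) (ha : 0 < a) :
    Real.log x ≤ x / a + Real.log a - 1 := by
  have := Real.log_le_sub_one_of_pos (div_pos hx ha)
  rw [Real.log_div hx.ne' ha.ne'] at this
  linarith

/-- The Gibbs bound: entropy is at most the logarithm of the number of atoms. -/
theorem neg_sum_mul_log_le_log_card {α : Type*} (A : Finset α) (p : α → ℝ)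
    (hp : ∀ a ∈ A, 0 ≤ p a) (h1 : ∑ a ∈ A, p a = 1) :
    -∑ a ∈ A, p a * Real.log (p a) ≤ Real.log A.card := by
  have hA : A.Nonempty := by
    rw [Finset.nonempty_iff_ne_empty]
    rintro rfl
    simp at h1
  have hc : (0 : ℝ) < A.card := by exact_mod_cast hA.card_pos
  have : ∀ a ∈ A, -(p a * Real.log (p a)) ≤
      1 / A.card + p a * (Real.log A.card - 1) := by
    intro a ha
    rcases (hp a ha).eq_or_lt with h0 | h0
    · rw [← h0]; simp
    · have := log_le_div_add_log_sub_one (inv_pos.2 h0) hc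
      rw [Real.log_inv] at this
      have h2 := mul_le_mul_of_nonneg_left this h0.le
      have h3 : p a * ((p a)⁻¹ / A.card + Real.log A.card - 1) =
        1 / A.card + p a * (Real.log A.card - 1) := by
        field_simp
        ring
      linarith
  calc -∑ a ∈ A, p a * Real.log (p a) = ∑ a ∈ A, -(p a * Real.log (p a)) := by simp
    _ ≤ ∑ a ∈ A, (1 / (A.card : ℝ) + p a * (Real.log A.card - 1)) := Finset.sum_le_sum this
    _ = Real.log A.card := by
      rw [Finset.sum_add_distrib, ← Finset.sum_mul, h1, Finset.sum_const, nsmul_eq_mul]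
      field_simp
      ring

/-- One scale step of the entropy estimate. The weights `r a b` are the joint law of a fine
cell `a` and an auxiliary cell `b`; `par a` is the coarse cell containing `a`. If each `b` meets at
most `L` coarse cells, then refining from the coarse to the fine cells increases the entropy by
at least the entropy of the fine cells conditioned on the auxiliary ones, minus `log L`. -/
theorem sum_mul_log_refine_le {α β γ : Type*} [DecidableEq γ]
    (A : Finset α) (B : Finset β) (Γ : Finset γ) (r : α → β → ℝ) (p : α → ℝ) (q : β → ℝ)
    (P : γ → ℝ) (par : α → γ) (L : ℕ) (hL : 0 < L)
    (hr : ∀ a ∈ A, ∀ b ∈ B, 0 ≤ r a b)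
    (hp : ∀ a ∈ A, p a = ∑ b ∈ B, r a b) (hq : ∀ b ∈ B, q b = ∑ a ∈ A, r a b)
    (hpar : ∀ a ∈ A, par a ∈ Γ)
    (hP : ∀ c ∈ Γ, P c = ∑ a ∈ A with par a = c, p a)
    (h1 : ∑ a ∈ A, p a = 1) (T : β → Finset γ) (hT : ∀ b ∈ B, (T b).card ≤ L)
    (hTm : ∀ a ∈ A, ∀ b ∈ B, r a b ≠ 0 → par a ∈ T b) :
    ∑ a ∈ A, p a * Real.log (p a) ≤ ∑ c ∈ Γ, P c * Real.log (P c) + Real.log L +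
      ∑ b ∈ B, ∑ a ∈ A, r a b * Real.log (r a b / q b) := by
  have hL' : (0 : ℝ) < L := by exact_mod_cast hL
  have hp0 : ∀ a ∈ A, 0 ≤ p a := fun a ha => by
    rw [hp a ha]; exact Finset.sum_nonneg (hr a ha)
  have hq0 : ∀ b ∈ B, 0 ≤ q b := fun b hb => by
    rw [hq b hb]; exact Finset.sum_nonneg fun a ha => hr a ha b hb
  have hP0 : ∀ c ∈ Γ, 0 ≤ P c := fun c hc => by
    rw [hP c hc]; exact Finset.sum_nonneg fun a ha => hp0 a (Finset.mem_filter.1 ha).1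
  have e1 : ∑ a ∈ A, p a * Real.log (p a) = ∑ b ∈ B, ∑ a ∈ A, r a b * Real.log (p a) := by
    rw [Finset.sum_comm]
    refine Finset.sum_congr rfl fun a ha => ?_
    rw [← Finset.sum_mul, ← hp a ha]
  have e2 : ∑ c ∈ Γ, P c * Real.log (P c) =
      ∑ b ∈ B, ∑ a ∈ A, r a b * Real.log (P (par a)) := by
    rw [Finset.sum_comm]
    have : ∀ a ∈ A, ∑ b ∈ B, r a b * Real.log (P (par a)) = p a * Real.log (P (par a)) :=
      fun a ha => by rw [← Finset.sum_mul, ← hp a ha]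
    rw [Finset.sum_congr rfl this, ← Finset.sum_fiberwise_of_maps_to hpar]
    refine Finset.sum_congr rfl fun c hc => ?_
    conv_lhs => rw [hP c hc, Finset.sum_mul, ← hP c hc]
    refine Finset.sum_congr rfl fun a ha => ?_
    rw [(Finset.mem_filter.1 ha).2]
  -- Gibbs' inequality for `r` against the weights `q b * p a / (P (par a) * L)` restricted to `par
  -- a ∈ T b`, via the tangent of `log` at `L`.
  have key : ∀ b ∈ B, ∀ a ∈ A, r a b * Real.log (p a) ≤ r a b * Real.log (P (par a)) +
      r a b * Real.log (r a b / q b) +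
      ((if par a ∈ T b then q b * (p a / P (par a)) / L else 0) +
        r a b * (Real.log L - 1)) := by
    intro b hb a ha
    rcases (hr a ha b hb).eq_or_lt with h0 | h0
    · rw [← h0]
      simp only [zero_mul, zero_add, add_zero]
      split_ifs
      · exact div_nonneg (mul_nonneg (hq0 b hb) (div_nonneg (hp0 a ha) (hP0 _ (hpar a ha)))) hL'.le
      · exact le_rfl
    · have hpa : 0 < p a := h0.trans_le (by
        rw [hp a ha]; exact Finset.single_le_sum (hr a ha) hb)
      have hqb : 0 < q b := h0.trans_le (by
        rw [hq b hb]
        exact Finset.single_le_sum (f := fun a => r a b) (fun a ha => hr a ha b hb) ha)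
      have hPa : 0 < P (par a) := hpa.trans_le (by
        rw [hP _ (hpar a ha)]
        exact Finset.single_le_sum (f := p)
          (fun a ha => hp0 a (Finset.mem_filter.1 ha).1) (Finset.mem_filter.2 ⟨ha, rfl⟩))
      rw [if_pos (hTm a ha b hb h0.ne')]
      have := log_le_div_add_log_sub_one (x := p a * q b / (P (par a) * r a b)) (by positivity) hL'
      rw [Real.log_div (by positivity) (by positivity), Real.log_mul hpa.ne' hqb.ne',
        Real.log_mul hPa.ne' h0.ne'] at this
      rw [Real.log_div h0.ne' hqb.ne']
      have h2 := mul_le_mul_of_nonneg_left this h0.le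
      have h3 : r a b * (p a * q b / (P (par a) * r a b) / L + Real.log L - 1) =
        q b * (p a / P (par a)) / L + r a b * (Real.log L - 1) := by
        field_simp
        ring
      linarith
  have sum1 : ∑ b ∈ B, ∑ a ∈ A, r a b = 1 := by
    rw [Finset.sum_comm, ← h1]
    exact Finset.sum_congr rfl fun a ha => (hp a ha).symm
  have sumq : ∑ b ∈ B, q b = 1 := by
    rw [← sum1]; exact Finset.sum_congr rfl hq
  -- The comparison weights have mass at most `q b`: the fractions `p a / P c` over the children of
  -- `c` sum to at most 1, and at most `L` cells `c` occur.
  have hfib : ∀ b ∈ B, ∑ a ∈ A, (if par a ∈ T b then q b * (p a / P (par a)) / L else 0) ≤ q b := by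
    intro b hb
    have hc : ∀ c ∈ Γ, ∑ a ∈ A with par a = c,
        (if par a ∈ T b then q b * (p a / P (par a)) / L else 0) ≤
        if c ∈ T b then q b / L else 0 := by
      intro c hc
      have : ∀ a ∈ A.filter (fun a => par a = c),
          (if par a ∈ T b then q b * (p a / P (par a)) / L else 0) =
          (if c ∈ T b then q b / L else 0) * (p a / P c) := by
        intro a ha
        rw [(Finset.mem_filter.1 ha).2]
        split_ifs
        · ring
        · simp
      rw [Finset.sum_congr rfl this, ← Finset.mul_sum, ← Finset.sum_div, ← hP c hc]
      refine mul_le_of_le_one_right ?_ (div_self_le_one _)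
      split_ifs
      · exact div_nonneg (hq0 b hb) hL'.le
      · exact le_rfl
    rw [← Finset.sum_fiberwise_of_maps_to hpar]
    refine (Finset.sum_le_sum hc).trans ?_
    rw [← Finset.sum_filter, Finset.sum_const, nsmul_eq_mul]
    have h5 : ((Γ.filter (fun c => c ∈ T b)).card : ℝ) ≤ L := by
      have : (Γ.filter (fun c => c ∈ T b)).card ≤ (T b).card :=
        Finset.card_le_card fun c hc => (Finset.mem_filter.1 hc).2
      exact_mod_cast this.trans (hT b hb)
    calc _ ≤ (L : ℝ) * (q b / L) :=
          mul_le_mul_of_nonneg_right h5 (div_nonneg (hq0 b hb) hL'.le)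
      _ = q b := by field_simp
  calc ∑ a ∈ A, p a * Real.log (p a)
      ≤ ∑ b ∈ B, ∑ a ∈ A, (r a b * Real.log (P (par a)) + r a b * Real.log (r a b / q b) +
      ((if par a ∈ T b then q b * (p a / P (par a)) / L else 0) +
        r a b * (Real.log L - 1))) := by
        rw [e1]
        exact Finset.sum_le_sum fun b hb => Finset.sum_le_sum (key b hb)
    _ = ∑ c ∈ Γ, P c * Real.log (P c) +
        ∑ b ∈ B, ∑ a ∈ A, r a b * Real.log (r a b / q b) +
        (∑ b ∈ B, ∑ a ∈ A, (if par a ∈ T b then q b * (p a / P (par a)) / L else 0) +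
          (Real.log L - 1)) := by
        rw [e2]
        simp only [Finset.sum_add_distrib, ← Finset.sum_mul, sum1, one_mul]
    _ ≤ _ := by
        have := (Finset.sum_le_sum hfib).trans_eq sumq
        linarith

/-- A conditional entropy is bounded below through the corresponding collision probability. -/
theorem sum_mul_log_div_le {α β : Type*} (A : Finset α) (B : Finset β) (r : α → β → ℝ) (q : β → ℝ)
    (hr : ∀ a ∈ A, ∀ b ∈ B, 0 ≤ r a b) (hq : ∀ b ∈ B, q b = ∑ a ∈ A, r a b)
    (h1 : ∑ b ∈ B, q b = 1) {M : ℝ} (hM : 0 < M) :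
    ∑ b ∈ B, ∑ a ∈ A, r a b * Real.log (r a b / q b) ≤
      (∑ b ∈ B, (∑ a ∈ A, r a b ^ 2) / q b) / M + Real.log M - 1 := by
  have key : ∀ b ∈ B, ∀ a ∈ A, r a b * Real.log (r a b / q b) ≤
      r a b ^ 2 / q b / M + r a b * (Real.log M - 1) := by
    intro b hb a ha
    rcases (hr a ha b hb).eq_or_lt with h0 | h0
    · rw [← h0]; simp
    · have hqb : 0 < q b := h0.trans_le (by
        rw [hq b hb]
        exact Finset.single_le_sum (f := fun a => r a b) (fun a ha => hr a ha b hb) ha)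
      have h2 := mul_le_mul_of_nonneg_left
        (log_le_div_add_log_sub_one (div_pos h0 hqb) hM) h0.le
      have h3 : r a b * (r a b / q b / M + Real.log M - 1) =
        r a b ^ 2 / q b / M + r a b * (Real.log M - 1) := by ring
      linarith
  refine (Finset.sum_le_sum fun b hb => Finset.sum_le_sum (key b hb)).trans_eq ?_
  simp only [Finset.sum_add_distrib, ← Finset.sum_mul, ← Finset.sum_div]
  rw [← Finset.sum_congr rfl hq, h1]
  ring

/-! ### Squares, strips and their indices -/

/-- The index of the square of side `ρ` containing `x`. -/
noncomputable def gridCell (ρ : ℝ) (x : EuclideanSpace ℝ (Fin 2)) : ℤ × ℤ := (⌊x 0 / ρ⌋, ⌊x 1 / ρ⌋)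

/-- The index of the strip of width `ρ`, in terms of the functional `x 0 + s * x 1`,
containing `x`. -/
noncomputable def stripIndex (s ρ : ℝ) (x : EuclideanSpace ℝ (Fin 2)) : ℤ := ⌊(x 0 + s * x 1) / ρ⌋

/-- The half-open unit square. -/
def unitSquare : Set (EuclideanSpace ℝ (Fin 2)) := {x | ∀ i, x i ∈ Set.Ico (0 : ℝ) 1}

open Classical in
/-- The indices of the squares of side `ρ` that meet `E`. -/
noncomputable def gridCells (E : Set (EuclideanSpace ℝ (Fin 2))) (ρ : ℝ) : Finset (ℤ × ℤ) :=
  (Finset.Icc 0 ⌊1 / ρ⌋ ×ˢ Finset.Icc 0 ⌊1 / ρ⌋).filter fun c => ∃ x ∈ E, gridCell ρ x = c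

open Classical in
/-- The indices of the strips of width `ρ` that meet `E`. -/
noncomputable def strips (E : Set (EuclideanSpace ℝ (Fin 2))) (s ρ : ℝ) : Finset ℤ :=
  (Finset.Icc 0 ⌊2 / ρ⌋).filter fun c => ∃ x ∈ E, stripIndex s ρ x = c

theorem mem_gridCells {E : Set (EuclideanSpace ℝ (Fin 2))} (hE : E ⊆ unitSquare) {ρ : ℝ}
    (hρ : 0 < ρ) {c : ℤ × ℤ} : c ∈ gridCells E ρ ↔ ∃ x ∈ E, gridCell ρ x = c := by
  simp only [gridCells, Finset.mem_filter, and_iff_right_iff_imp]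
  rintro ⟨x, hx, rfl⟩
  simp only [gridCell, Finset.mem_product, Finset.mem_Icc]
  have h (i : Fin 2) : 0 ≤ ⌊x i / ρ⌋ ∧ ⌊x i / ρ⌋ ≤ ⌊1 / ρ⌋ :=
    ⟨Int.floor_nonneg.2 (div_nonneg (hE hx i).1 hρ.le),
      Int.floor_le_floor (div_le_div_of_nonneg_right (hE hx i).2.le hρ.le)⟩
  exact ⟨h 0, h 1⟩

theorem mem_strips {E : Set (EuclideanSpace ℝ (Fin 2))} (hE : E ⊆ unitSquare) {s ρ : ℝ}
    (hs : s ∈ Set.Icc (0 : ℝ) 1) (hρ : 0 < ρ) {c : ℤ} :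
    c ∈ strips E s ρ ↔ ∃ x ∈ E, stripIndex s ρ x = c := by
  simp only [strips, Finset.mem_filter, and_iff_right_iff_imp]
  rintro ⟨x, hx, rfl⟩
  obtain ⟨h0, h0'⟩ := hE hx 0
  obtain ⟨h1, h1'⟩ := hE hx 1
  rw [stripIndex, Finset.mem_Icc]
  refine ⟨Int.floor_nonneg.2 (div_nonneg (add_nonneg h0 (mul_nonneg hs.1 h1)) hρ.le),
    Int.floor_le_floor (div_le_div_of_nonneg_right ?_ hρ.le)⟩
  nlinarith [mul_le_mul hs.2 h1'.le h1 zero_le_one]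

theorem measurable_gridCell (ρ : ℝ) : Measurable (gridCell ρ) := by
  unfold gridCell
  fun_prop

theorem measurable_stripIndex (s ρ : ℝ) : Measurable (stripIndex s ρ) := by
  unfold stripIndex
  fun_prop

theorem abs_sub_lt_of_floor_div_eq {u v ρ : ℝ} (hρ : 0 < ρ) (h : ⌊u / ρ⌋ = ⌊v / ρ⌋) :
    |u - v| < ρ := by
  have := Int.abs_sub_lt_one_of_floor_eq_floor h
  rwa [← sub_div, abs_div, abs_of_pos hρ, div_lt_one hρ] at this

theorem abs_floor_div_sub_le_one {u v ρ : ℝ} (hρ : 0 < ρ) (h : |u - v| ≤ ρ) :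
    |⌊u / ρ⌋ - ⌊v / ρ⌋| ≤ 1 := by
  have h1 : |u / ρ - v / ρ| ≤ 1 := by
    rwa [← sub_div, abs_div, abs_of_pos hρ, div_le_one hρ]
  rw [abs_le] at h1 ⊢
  have a1 := Int.floor_le (u / ρ)
  have a2 := Int.lt_floor_add_one (u / ρ)
  have b1 := Int.floor_le (v / ρ)
  have b2 := Int.lt_floor_add_one (v / ρ)
  have c1 : ((⌊u / ρ⌋ : ℤ) : ℝ) < ((⌊v / ρ⌋ + 2 : ℤ) : ℝ) := by push_cast; linarith
  have c2 : ((⌊v / ρ⌋ : ℤ) : ℝ) < ((⌊u / ρ⌋ + 2 : ℤ) : ℝ) := by push_cast; linarith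
  rw [Int.cast_lt] at c1 c2
  constructor <;> omega

theorem dist_plane_sq (x y : EuclideanSpace ℝ (Fin 2)) :
    dist x y ^ 2 = (x 0 - y 0) ^ 2 + (x 1 - y 1) ^ 2 := by
  rw [EuclideanSpace.dist_sq_eq, Fin.sum_univ_two, Real.dist_eq, Real.dist_eq, sq_abs, sq_abs]

theorem abs_coord_sub_le_dist (x y : EuclideanSpace ℝ (Fin 2)) (i : Fin 2) :
    |x i - y i| ≤ dist x y := by
  refine abs_le_of_sq_le_sq ?_ dist_nonneg
  rw [dist_plane_sq]
  fin_cases i <;> simp <;> positivity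

theorem dist_le_add_abs (x y : EuclideanSpace ℝ (Fin 2)) :
    dist x y ≤ |x 0 - y 0| + |x 1 - y 1| := by
  refine abs_le_of_sq_le_sq' ?_ (by positivity) |>.2
  rw [dist_plane_sq]
  nlinarith [abs_nonneg (x 0 - y 0), abs_nonneg (x 1 - y 1), sq_abs (x 0 - y 0),
    sq_abs (x 1 - y 1)]

theorem dist_le_of_gridCell_eq {ρ : ℝ} (hρ : 0 < ρ) {x y : EuclideanSpace ℝ (Fin 2)}
    (h : gridCell ρ x = gridCell ρ y) : dist x y ≤ 2 * ρ := by
  rw [gridCell, gridCell, Prod.mk.injEq] at h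
  have h0 := abs_sub_lt_of_floor_div_eq hρ h.1
  have h1 := abs_sub_lt_of_floor_div_eq hρ h.2
  linarith [dist_le_add_abs x y]

/-! ### Regular measures and transversality -/

/-- A probability measure carried by a subset `E` of the unit square whose balls centred on `E`
have measure comparable to `r ^ t`, with constant `K`. -/
structure IsRegularProbability (t K : ℝ) (E : Set (EuclideanSpace ℝ (Fin 2)))
    (ν : Measure (EuclideanSpace ℝ (Fin 2))) : Prop where
  isProbabilityMeasure : IsProbabilityMeasure ν
  subset_unitSquare : E ⊆ unitSquare
  one_le : 1 ≤ K
  measure_compl : ν Eᶜ = 0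
  le_closedBall : ∀ x ∈ E, ∀ r, 0 < r → r ≤ 1 → r ^ t / K ≤ ν.real (Metric.closedBall x r)
  closedBall_le : ∀ x ∈ E, ∀ r, 0 < r → ν.real (Metric.closedBall x r) ≤ K * r ^ t

theorem card_le_of_abs_sub_le (T : Finset ℕ) (a l : ℝ) (hl : 0 ≤ l)
    (h : ∀ j ∈ T, |(j : ℝ) - a| ≤ l) : (T.card : ℝ) ≤ 2 * l + 1 := by
  have hsub : T.map ⟨((↑) : ℕ → ℤ), Nat.cast_injective⟩ ⊆ Finset.Icc ⌈a - l⌉ ⌊a + l⌋ := by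
    intro z hz
    obtain ⟨j, hj, rfl⟩ := Finset.mem_map.1 hz
    have := abs_le.1 (h j hj)
    simp only [Function.Embedding.coeFn_mk, Finset.mem_Icc]
    refine ⟨Int.ceil_le.2 ?_, Int.le_floor.2 ?_⟩ <;> push_cast <;> linarith
  have h1 := Finset.card_le_card hsub
  rw [Finset.card_map, Int.card_Icc] at h1
  have h2 : (T.card : ℝ) ≤ ((⌊a + l⌋ + 1 - ⌈a - l⌉).toNat : ℝ) := by exact_mod_cast h1
  refine h2.trans ?_
  rcases le_total 0 (⌊a + l⌋ + 1 - ⌈a - l⌉) with h3 | h3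
  · have h4 : ((⌊a + l⌋ + 1 - ⌈a - l⌉).toNat : ℝ) = ((⌊a + l⌋ + 1 - ⌈a - l⌉ : ℤ) : ℝ) := by
      exact_mod_cast congrArg (Int.cast : ℤ → ℝ) (Int.toNat_of_nonneg h3)
    rw [h4]
    push_cast
    linarith [Int.floor_le (a + l), Int.le_ceil (a - l)]
  · rw [Int.toNat_of_nonpos h3]
    simp
    linarith

/-- Transversality: few of the slopes `j / b` bring `v₀ + (j / b) * v₁` close to `0`. -/
theorem card_slopes_le (b : ℕ) (hb : 0 < b) (v₀ v₁ δ d : ℝ) (hδ : 0 < δ) (hd : 0 < d)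
    (hv : d ≤ |v₀| + |v₁|) (T : Finset ℕ) (hTb : T ⊆ Finset.range b)
    (hT : ∀ j ∈ T, |v₀ + (j / b : ℝ) * v₁| ≤ δ) :
    (T.card : ℝ) ≤ 6 * b * δ / d + 1 := by
  have hb' : (0 : ℝ) < b := by exact_mod_cast hb
  -- If `v₀` dominates, a slope in `T` forces `d ≤ 3 * δ`, and the trivial bound `b` suffices.
  -- Otherwise `d ≤ 3 * |v₁|`, and `j` is confined to an interval of half-length `b * δ / |v₁|`.
  rcases le_or_gt (2 * |v₁|) |v₀| with hc | hc
  · rcases T.eq_empty_or_nonempty with rfl | ⟨j, hj⟩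
    · simp; positivity
    have hj1 : (j / b : ℝ) ≤ 1 := by
      rw [div_le_one hb']
      exact_mod_cast (Finset.mem_range.1 (hTb hj)).le
    have hj0 : (0 : ℝ) ≤ j / b := by positivity
    have h1 : |v₀| ≤ δ + |v₁| := by
      calc |v₀| = |(v₀ + (j / b : ℝ) * v₁) - (j / b : ℝ) * v₁| := by ring_nf
        _ ≤ |v₀ + (j / b : ℝ) * v₁| + |(j / b : ℝ) * v₁| := abs_sub _ _
        _ ≤ δ + |v₁| := by
          rw [abs_mul, abs_of_nonneg hj0]
          nlinarith [hT j hj, abs_nonneg v₁]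
    have hcard : (T.card : ℝ) ≤ b := by
      have := Finset.card_le_card hTb
      rw [Finset.card_range] at this
      exact_mod_cast this
    have : (b : ℝ) ≤ 6 * b * δ / d := by
      rw [le_div_iff₀ hd]
      nlinarith
    linarith
  · have hv1 : 0 < |v₁| := by linarith [abs_nonneg v₀]
    have := card_le_of_abs_sub_le T (-(b * v₀ / v₁)) (b * δ / |v₁|) (by positivity) (by
      intro j hj
      have h1 := hT j hj
      have hv1' : v₁ ≠ 0 := abs_pos.1 hv1
      rw [le_div_iff₀ hv1, ← abs_mul]
      have h2 : (j - -(b * v₀ / v₁)) * v₁ = b * (v₀ + (j / b : ℝ) * v₁) := by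
        field_simp
        ring
      rw [h2, abs_mul, abs_of_pos hb']
      exact mul_le_mul_of_nonneg_left h1 hb'.le)
    refine this.trans ?_
    have : 2 * (b * δ / |v₁|) ≤ 6 * b * δ / d := by
      rw [← mul_div_assoc, div_le_div_iff₀ hv1 hd]
      have : 0 < b * δ := by positivity
      nlinarith
    linarith

/-- The number of the cells of side `ρ` that meet a `t`-regular set is at most of
order `ρ ^ (-t)`. -/
theorem IsRegularProbability.card_gridCells_le {t K : ℝ} {E : Set (EuclideanSpace ℝ (Fin 2))}
    {ν : Measure (EuclideanSpace ℝ (Fin 2))} (h : IsRegularProbability t K E ν) {ρ : ℝ}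
    (hρ : 0 < ρ) (hρ1 : ρ ≤ 1) : (gridCells E ρ).card * ρ ^ t ≤ 9 * K := by
  have := h.isProbabilityMeasure
  have hK : 0 < K := zero_lt_one.trans_le h.one_le
  have hx : ∀ c : ℤ × ℤ, ∃ x, c ∈ gridCells E ρ → x ∈ E ∧ gridCell ρ x = c := by
    intro c
    by_cases hc : c ∈ gridCells E ρ
    · obtain ⟨x, hx⟩ := (mem_gridCells h.subset_unitSquare hρ).1 hc
      exact ⟨x, fun _ => hx⟩
    · exact ⟨0, fun h => absurd h hc⟩
  choose x hx using hx
  -- Bounded overlap: a point lies in at most nine of these balls, as their centres lie in its own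
  -- cell or the eight adjacent ones.
  have h1 : ∑ c ∈ gridCells E ρ, 1 * ν.real (Metric.closedBall (x c) ρ) ≤
      ∑ k ∈ ({()} : Finset Unit), 9 * ν.real (Set.univ) := by
    refine sum_mul_measureReal_le_of_indicator_le h.measure_compl _ _ _ _ _ _
      (fun _ _ => Metric.isClosed_closedBall.measurableSet) (fun _ _ => MeasurableSet.univ) ?_
    classical
    intro y hy
    simp only [Set.indicator_apply, Set.mem_univ, if_true, Finset.sum_singleton]
    rw [← Finset.sum_filter, Finset.sum_const, nsmul_eq_mul, mul_one]
    have hsub : (gridCells E ρ).filter (fun c => y ∈ Metric.closedBall (x c) ρ) ⊆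
        Finset.Icc ((gridCell ρ y).1 - 1) ((gridCell ρ y).1 + 1) ×ˢ
          Finset.Icc ((gridCell ρ y).2 - 1) ((gridCell ρ y).2 + 1) := by
      intro c hc
      rw [Finset.mem_filter, Metric.mem_closedBall] at hc
      obtain ⟨hc, hd⟩ := hc
      have hcx := (hx c hc).2
      have e (i : Fin 2) := abs_le.1 (abs_floor_div_sub_le_one hρ
        ((abs_coord_sub_le_dist y (x c) i).trans hd))
      have e0 := e 0
      have e1 := e 1
      rw [← hcx]
      simp only [gridCell, Finset.mem_product, Finset.mem_Icc]
      omega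
    have h2 := Finset.card_le_card hsub
    rw [Finset.card_product, Int.card_Icc, Int.card_Icc] at h2
    have h3 : ((gridCell ρ y).1 + 1 + 1 - ((gridCell ρ y).1 - 1)).toNat = 3 := by
      have : (gridCell ρ y).1 + 1 + 1 - ((gridCell ρ y).1 - 1) = 3 := by ring
      rw [this]; rfl
    have h4 : ((gridCell ρ y).2 + 1 + 1 - ((gridCell ρ y).2 - 1)).toNat = 3 := by
      have : (gridCell ρ y).2 + 1 + 1 - ((gridCell ρ y).2 - 1) = 3 := by ring
      rw [this]; rfl
    rw [h3, h4] at h2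
    exact_mod_cast h2
  rw [Finset.sum_singleton, probReal_univ, mul_one] at h1
  simp only [one_mul] at h1
  have h2 : ∑ c ∈ gridCells E ρ, ρ ^ t / K ≤ 9 :=
    (Finset.sum_le_sum fun c hc => h.le_closedBall (x c) (hx c hc).1 ρ hρ hρ1).trans h1
  rw [Finset.sum_const, nsmul_eq_mul, ← mul_div_assoc, div_le_iff₀ hK] at h2
  exact h2

/-- The number of slopes for which two points of the same square fall in the same thin strip,
bounded through the dyadic annuli around one of them. -/
theorem card_same_strip_le (m : ℕ) {ρ : ℝ} (hρ : 0 < ρ) {x y : EuclideanSpace ℝ (Fin 2)}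
    (h : gridCell ρ x = gridCell ρ y) :
    (((Finset.range (2 ^ m)).filter fun j : ℕ =>
      stripIndex ((j : ℝ) / (2 ^ m : ℕ)) (ρ / (2 ^ m : ℕ)) x =
        stripIndex ((j : ℝ) / (2 ^ m : ℕ)) (ρ / (2 ^ m : ℕ)) y).card : ℝ) ≤
      ∑ i ∈ Finset.range (m + 1), if dist x y ≤ 2 * ρ / 2 ^ i then (8 * 2 ^ i : ℝ) else 0 := by
  set T := (Finset.range (2 ^ m)).filter fun j : ℕ =>
      stripIndex ((j : ℝ) / (2 ^ m : ℕ)) (ρ / (2 ^ m : ℕ)) x =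
        stripIndex ((j : ℝ) / (2 ^ m : ℕ)) (ρ / (2 ^ m : ℕ)) y with hTdef
  have hd2 := dist_le_of_gridCell_eq hρ h
  obtain ⟨i, him, hPi, hT⟩ : ∃ i ≤ m, dist x y ≤ 2 * ρ / 2 ^ i ∧ (T.card : ℝ) ≤ 8 * 2 ^ i := by
    classical
    -- The dyadic annulus containing `y`. At `i = m` the count is trivial; otherwise transversality
    -- gives `6 * 2 ^ i + 1`, and `dist x y ≤ 2 * ρ` absorbs the final 1, whence the 8.
    set i := Nat.findGreatest (fun i => dist x y ≤ 2 * ρ / 2 ^ i) m with hi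
    have him : i ≤ m := Nat.findGreatest_le m
    have hPi : dist x y ≤ 2 * ρ / 2 ^ i :=
      Nat.findGreatest_spec (P := fun i => dist x y ≤ 2 * ρ / 2 ^ i) (Nat.zero_le m) (by simpa)
    refine ⟨i, him, hPi, ?_⟩
    rcases him.eq_or_lt with him' | him'
    · have h1 := Finset.card_le_card (Finset.filter_subset _ _ : T ⊆ Finset.range (2 ^ m))
      rw [Finset.card_range] at h1
      have h2 : (T.card : ℝ) ≤ 2 ^ m := by exact_mod_cast h1
      rw [him']
      linarith [pow_pos (zero_lt_two (α := ℝ)) m]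
    · have hn : ¬ dist x y ≤ 2 * ρ / 2 ^ (i + 1) :=
        Nat.findGreatest_is_greatest (P := fun i => dist x y ≤ 2 * ρ / 2 ^ i)
          (Nat.lt_succ_self i) him'
      have h2i : (0 : ℝ) < 2 ^ i := by positivity
      have hlt : ρ / 2 ^ i < dist x y := by
        rw [not_le, pow_succ] at hn
        rwa [mul_comm ((2 : ℝ) ^ i), mul_div_mul_left _ _ (two_ne_zero' ℝ)] at hn
      have hd : 0 < dist x y := (by positivity : 0 < ρ / 2 ^ i).trans hlt
      have hb : (0 : ℝ) < (2 ^ m : ℕ) := by positivity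
      have := card_slopes_le (2 ^ m) (by positivity) (x 0 - y 0) (x 1 - y 1) (ρ / (2 ^ m : ℕ))
        (dist x y) (by positivity) hd (dist_le_add_abs x y) T (Finset.filter_subset _ _) (by
          intro j hj
          have := (abs_sub_lt_of_floor_div_eq (by positivity) (Finset.mem_filter.1 hj).2).le
          rwa [show x 0 - y 0 + (j : ℝ) / (2 ^ m : ℕ) * (x 1 - y 1) =
            (x 0 + (j : ℝ) / (2 ^ m : ℕ) * x 1) - (y 0 + (j : ℝ) / (2 ^ m : ℕ) * y 1) by ring])
      refine this.trans ?_
      have h3 : 6 * ((2 ^ m : ℕ) : ℝ) * (ρ / (2 ^ m : ℕ)) / dist x y = 6 * (ρ / dist x y) := by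
        field_simp
      have h4 : ρ / dist x y ≤ 2 ^ i := by
        rw [div_le_iff₀ hd]
        rw [div_lt_iff₀ h2i] at hlt
        linarith
      have h5 : 1 ≤ 2 * (ρ / dist x y) := by
        rw [← mul_div_assoc, le_div_iff₀ hd]
        linarith
      rw [h3]
      linarith
  refine hT.trans ?_
  have := Finset.single_le_sum (f := fun i => if dist x y ≤ 2 * ρ / 2 ^ i then (8 * 2 ^ i : ℝ) else 0)
    (fun j _ => by positivity) (Finset.mem_range.2 (Nat.lt_succ_of_le him))
  simpa only [if_pos hPi] using this

/-- Averaged over slopes, thin strips through a point carry little mass inside a square. -/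
theorem IsRegularProbability.sum_measureReal_strip_le {t K : ℝ}
    {E : Set (EuclideanSpace ℝ (Fin 2))}
    {ν : Measure (EuclideanSpace ℝ (Fin 2))} (h : IsRegularProbability t K E ν)
    (ht2 : t ≤ 2) (m : ℕ) {ρ : ℝ} (hρ : 0 < ρ) {x : EuclideanSpace ℝ (Fin 2)} (hx : x ∈ E) :
    ∑ j ∈ Finset.range (2 ^ m), ν.real
      (stripIndex ((j : ℝ) / (2 ^ m : ℕ)) (ρ / (2 ^ m : ℕ)) ⁻¹'
        {stripIndex ((j : ℝ) / (2 ^ m : ℕ)) (ρ / (2 ^ m : ℕ)) x} ∩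
        gridCell ρ ⁻¹' {gridCell ρ x}) ≤
      32 * K * (m + 1) * ((2 : ℝ) ^ m) ^ (1 - min t 1) * ρ ^ t := by
  have := h.isProbabilityMeasure
  have hK : 0 < K := zero_lt_one.trans_le h.one_le
  have h1 := sum_mul_measureReal_le_of_indicator_le (ν := ν) h.measure_compl
    (Finset.range (2 ^ m)) (Finset.range (m + 1)) (fun _ => 1) (fun i => 8 * 2 ^ i)
    (fun j => stripIndex ((j : ℝ) / (2 ^ m : ℕ)) (ρ / (2 ^ m : ℕ)) ⁻¹'
        {stripIndex ((j : ℝ) / (2 ^ m : ℕ)) (ρ / (2 ^ m : ℕ)) x} ∩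
        gridCell ρ ⁻¹' {gridCell ρ x}) (fun i => Metric.closedBall x (2 * ρ / 2 ^ i))
    (fun j _ => (measurable_stripIndex _ _ (measurableSet_singleton _)).inter
      (measurable_gridCell _ (measurableSet_singleton _)))
    (fun i _ => Metric.isClosed_closedBall.measurableSet) (by
      classical
      intro y _
      simp only [Set.indicator_apply, Set.mem_inter_iff, Set.mem_preimage,
        Set.mem_singleton_iff, Metric.mem_closedBall]
      by_cases hy : gridCell ρ y = gridCell ρ x
      · have := card_same_strip_le m hρ hy
        simp only [hy, and_true]
        rw [← Finset.sum_filter, Finset.sum_const, nsmul_eq_mul, mul_one]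
        exact this
      · simp only [hy, and_false, if_false, Finset.sum_const_zero]
        exact Finset.sum_nonneg fun i _ => by positivity)
  simp only [one_mul] at h1
  refine h1.trans ?_
  -- Each annulus contributes a multiple of `2 ^ (i * (1 - t))`. All are bounded by the same
  -- quantity, costing a factor `m + 1`; the 32 is 8 times the bound 4 for `2 ^ t`.
  have h2 : ∀ i ∈ Finset.range (m + 1),
      8 * 2 ^ i * ν.real (Metric.closedBall x (2 * ρ / 2 ^ i)) ≤
        32 * K * ((2 : ℝ) ^ m) ^ (1 - min t 1) * ρ ^ t := by
    intro i hi
    have h2i : (0 : ℝ) < 2 ^ i := by positivity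
    have e1 := h.closedBall_le x hx (2 * ρ / 2 ^ i) (by positivity)
    have e2 : (2 * ρ / 2 ^ i : ℝ) ^ t = 2 ^ t * ρ ^ t / (2 ^ i) ^ t := by
      rw [Real.div_rpow (by positivity) h2i.le, Real.mul_rpow zero_le_two hρ.le]
    have e3 : (2 : ℝ) ^ t ≤ 4 := by
      calc (2 : ℝ) ^ t ≤ 2 ^ (2 : ℝ) := Real.rpow_le_rpow_of_exponent_le one_le_two ht2
        _ = 4 := by norm_num
    have e4 : (2 : ℝ) ^ i / (2 ^ i) ^ t ≤ (2 ^ m) ^ (1 - min t 1) := by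
      calc (2 : ℝ) ^ i / (2 ^ i) ^ t = (2 ^ i) ^ (1 - t) := by
            rw [Real.rpow_sub h2i, Real.rpow_one]
        _ ≤ (2 ^ i) ^ (1 - min t 1) :=
            Real.rpow_le_rpow_of_exponent_le (one_le_pow₀ one_le_two)
              (by linarith [min_le_left t 1])
        _ ≤ (2 ^ m) ^ (1 - min t 1) :=
            Real.rpow_le_rpow h2i.le
              (pow_le_pow_right₀ one_le_two (Nat.lt_succ_iff.1 (Finset.mem_range.1 hi)))
              (by linarith [min_le_right t 1])
    have hρt : 0 < ρ ^ t := Real.rpow_pos_of_pos hρ t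
    calc 8 * 2 ^ i * ν.real (Metric.closedBall x (2 * ρ / 2 ^ i))
        ≤ 8 * 2 ^ i * (K * (2 ^ t * ρ ^ t / (2 ^ i) ^ t)) := by
          rw [← e2]; exact mul_le_mul_of_nonneg_left e1 (by positivity)
      _ = 8 * K * ρ ^ t * (2 ^ t * ((2 : ℝ) ^ i / (2 ^ i) ^ t)) := by ring
      _ ≤ 8 * K * ρ ^ t * (4 * (2 ^ m) ^ (1 - min t 1)) := by gcongr
      _ = _ := by ring
  refine (Finset.sum_le_sum h2).trans_eq ?_
  rw [Finset.sum_const, Finset.card_range, nsmul_eq_mul]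
  push_cast
  ring

/-- The collision probabilities of the strips inside a square, summed over slopes. -/
theorem IsRegularProbability.sum_sq_measureReal_le {t K : ℝ}
    {E : Set (EuclideanSpace ℝ (Fin 2))}
    {ν : Measure (EuclideanSpace ℝ (Fin 2))} (h : IsRegularProbability t K E ν)
    (ht2 : t ≤ 2) (m : ℕ) {ρ : ℝ} (hρ : 0 < ρ) (c : ℤ × ℤ) :
    ∑ j ∈ Finset.range (2 ^ m),
      ∑ a ∈ strips E ((j : ℝ) / (2 ^ m : ℕ)) (ρ / (2 ^ m : ℕ)), ν.real
        (stripIndex ((j : ℝ) / (2 ^ m : ℕ)) (ρ / (2 ^ m : ℕ)) ⁻¹' {a} ∩ gridCell ρ ⁻¹' {c}) ^ 2 ≤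
      32 * K * (m + 1) * ((2 : ℝ) ^ m) ^ (1 - min t 1) * ρ ^ t *
        ν.real (gridCell ρ ⁻¹' {c}) := by
  have := h.isProbabilityMeasure
  have hK : 0 < K := zero_lt_one.trans_le h.one_le
  set A : ℕ → ℤ → Set (EuclideanSpace ℝ (Fin 2)) := fun j a =>
    stripIndex ((j : ℝ) / (2 ^ m : ℕ)) (ρ / (2 ^ m : ℕ)) ⁻¹' {a} ∩ gridCell ρ ⁻¹' {c} with hA
  -- A squared mass is the integral over the set of its own mass, so the sum over strips becomes an
  -- integral over `x` of the mass of the strip through `x`, already bounded.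
  have h1 := sum_mul_measureReal_le_of_indicator_le (ν := ν) h.measure_compl
    ((Finset.range (2 ^ m)).sigma
      fun j => strips E ((j : ℝ) / (2 ^ m : ℕ)) (ρ / (2 ^ m : ℕ))) ({()} : Finset Unit)
    (fun p => ν.real (A p.1 p.2))
    (fun _ => 32 * K * (m + 1) * ((2 : ℝ) ^ m) ^ (1 - min t 1) * ρ ^ t)
    (fun p => A p.1 p.2) (fun _ => gridCell ρ ⁻¹' {c})
    (fun j _ => (measurable_stripIndex _ _ (measurableSet_singleton _)).inter
      (measurable_gridCell _ (measurableSet_singleton _)))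
    (fun _ _ => measurable_gridCell _ (measurableSet_singleton _)) (by
      intro x hx
      rw [Finset.sum_sigma, Finset.sum_singleton]
      by_cases hxc : gridCell ρ x = c
      · refine (Finset.sum_le_sum (g := fun j => ν.real
          (A j (stripIndex ((j : ℝ) / (2 ^ m : ℕ)) (ρ / (2 ^ m : ℕ)) x))) fun j _ => ?_).trans ?_
        · refine (Finset.sum_eq_single_of_mem
            (stripIndex ((j : ℝ) / (2 ^ m : ℕ)) (ρ / (2 ^ m : ℕ)) x) ?_ ?_).trans_le ?_
          · simp only [strips, Finset.mem_filter]
            have hj : (j : ℝ) / (2 ^ m : ℕ) ∈ Set.Icc (0 : ℝ) 1 := by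
              have : j < 2 ^ m := by simpa using ‹j ∈ Finset.range (2 ^ m)›
              refine ⟨by positivity, div_le_one_of_le₀ ?_ (by positivity)⟩
              exact_mod_cast this.le
            have := (mem_strips h.subset_unitSquare hj
              (ρ := ρ / (2 ^ m : ℕ)) (by positivity)).2 ⟨x, hx, rfl⟩
            simpa only [strips, Finset.mem_filter] using this
          · intro a _ hne
            refine Set.indicator_of_notMem ?_ _
            exact fun hmem => hne hmem.1.symm
          · exact Set.indicator_le_self' (fun _ _ => measureReal_nonneg) x
        · rw [Set.indicator_of_mem (show x ∈ gridCell ρ ⁻¹' {c} from hxc)]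
          have := h.sum_measureReal_strip_le ht2 m hρ hx
          rw [hxc] at this
          exact this
      · rw [Set.indicator_of_notMem (show x ∉ gridCell ρ ⁻¹' {c} from hxc)]
        refine Finset.sum_nonpos fun j _ => Finset.sum_nonpos fun a _ => ?_
        rw [Set.indicator_of_notMem]
        exact fun hmem => hxc hmem.2)
  rw [Finset.sum_sigma, Finset.sum_singleton] at h1
  simpa only [sq] using h1

/-! ### Entropy of strips across scales -/

/-- A finite measure carried by `E` splits along the fibres of a map with finitely many values
on `E`. -/
theorem measureReal_eq_sum_fiber {X ι : Type*} [MeasurableSpace X] [MeasurableSpace ι]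
    [MeasurableSingletonClass ι] {ν : Measure X} [IsFiniteMeasure ν] {E : Set X}
    (hE : ν Eᶜ = 0) {f : X → ι} (hf : Measurable f) (S : Finset ι) (hS : ∀ x ∈ E, f x ∈ S)
    {A : Set X} (hA : MeasurableSet A) :
    ν.real A = ∑ i ∈ S, ν.real (A ∩ f ⁻¹' {i}) := by
  classical
  have hm : ∀ i ∈ S, MeasurableSet (A ∩ f ⁻¹' {i}) := fun i _ =>
    hA.inter (hf (measurableSet_singleton i))
  have hpt : ∀ x ∈ E, ∑ i ∈ S, (A ∩ f ⁻¹' {i}).indicator (fun _ => (1 : ℝ)) x =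
      ∑ _k ∈ ({()} : Finset Unit), A.indicator (fun _ => (1 : ℝ)) x := by
    intro x hx
    rw [Finset.sum_singleton, Finset.sum_eq_single_of_mem (f x) (hS x hx)]
    · by_cases h : x ∈ A <;> simp [h]
    · intro i _ hne
      exact Set.indicator_of_notMem (fun h => hne h.2.symm) _
  have h1 := sum_mul_measureReal_le_of_indicator_le hE S {()} (fun _ => 1) (fun _ => 1) _
    (fun _ => A) hm (fun _ _ => hA) (fun x hx => (hpt x hx).le)
  have h2 := sum_mul_measureReal_le_of_indicator_le hE {()} S (fun _ => 1) (fun _ => 1)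
    (fun _ => A) _ (fun _ _ => hA) hm (fun x hx => (hpt x hx).ge)
  simp only [one_mul, Finset.sum_singleton] at h1 h2
  exact le_antisymm h2 h1

/-- The negative of the entropy of `ν` with respect to the strips of width `ρ`. -/
noncomputable def stripNegEntropy (ν : Measure (EuclideanSpace ℝ (Fin 2)))
    (E : Set (EuclideanSpace ℝ (Fin 2))) (s ρ : ℝ) : ℝ :=
  ∑ a ∈ strips E s ρ,
    ν.real (stripIndex s ρ ⁻¹' {a}) * Real.log (ν.real (stripIndex s ρ ⁻¹' {a}))

/-- Thin strips are nested in wide ones, so integer division by `b` is the parent map of the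
refinement. -/
theorem stripIndex_div (s ρ : ℝ) {b : ℕ} (hb : 0 < b) (x : EuclideanSpace ℝ (Fin 2)) :
    stripIndex s (ρ / b) x / b = stripIndex s ρ x := by
  have hb' : (b : ℝ) ≠ 0 := by exact_mod_cast hb.ne'
  rw [stripIndex, stripIndex, ← Int.floor_div_natCast, div_div, div_mul_cancel₀ _ hb']

namespace IsRegularProbability

variable {t K : ℝ} {E : Set (EuclideanSpace ℝ (Fin 2))}
  {ν : Measure (EuclideanSpace ℝ (Fin 2))}

theorem sum_measureReal_strip_eq_one (h : IsRegularProbability t K E ν) {s ρ : ℝ}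
    (hs : s ∈ Set.Icc (0 : ℝ) 1) (hρ : 0 < ρ) :
    ∑ a ∈ strips E s ρ, ν.real (stripIndex s ρ ⁻¹' {a}) = 1 := by
  have := h.isProbabilityMeasure
  have h1 := measureReal_eq_sum_fiber h.measure_compl (measurable_stripIndex s ρ)
    (strips E s ρ) (fun x hx => (mem_strips h.subset_unitSquare hs hρ).2 ⟨x, hx, rfl⟩)
    MeasurableSet.univ
  simpa using h1.symm

theorem sum_measureReal_gridCell_eq_one (h : IsRegularProbability t K E ν) {ρ : ℝ}
    (hρ : 0 < ρ) : ∑ c ∈ gridCells E ρ, ν.real (gridCell ρ ⁻¹' {c}) = 1 := by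
  have := h.isProbabilityMeasure
  have h1 := measureReal_eq_sum_fiber h.measure_compl (measurable_gridCell ρ)
    (gridCells E ρ) (fun x hx => (mem_gridCells h.subset_unitSquare hρ).2 ⟨x, hx, rfl⟩)
    MeasurableSet.univ
  simpa using h1.symm

theorem measureReal_gridCell_eq_sum (h : IsRegularProbability t K E ν) {s ρ δ : ℝ}
    (hs : s ∈ Set.Icc (0 : ℝ) 1) (hδ : 0 < δ) (c : ℤ × ℤ) :
    ν.real (gridCell ρ ⁻¹' {c}) =
      ∑ a ∈ strips E s δ, ν.real (stripIndex s δ ⁻¹' {a} ∩ gridCell ρ ⁻¹' {c}) := by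
  have := h.isProbabilityMeasure
  rw [measureReal_eq_sum_fiber h.measure_compl (measurable_stripIndex s δ)
    (strips E s δ) (fun x hx => (mem_strips h.subset_unitSquare hs hδ).2 ⟨x, hx, rfl⟩)
    (measurable_gridCell ρ (measurableSet_singleton c))]
  simp only [Set.inter_comm]

/-- Passing from strips of width `ρ` to strips of width `ρ / b` increases the entropy at least by
the conditional entropy given the squares of side `ρ`, up to a constant. -/
theorem stripNegEntropy_refine_le (h : IsRegularProbability t K E ν) {s ρ : ℝ}
    (hs : s ∈ Set.Icc (0 : ℝ) 1) (hρ : 0 < ρ) {b : ℕ} (hb : 0 < b) :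
    stripNegEntropy ν E s (ρ / b) ≤ stripNegEntropy ν E s ρ + Real.log 3 +
      ∑ c ∈ gridCells E ρ, ∑ a ∈ strips E s (ρ / b),
        ν.real (stripIndex s (ρ / b) ⁻¹' {a} ∩ gridCell ρ ⁻¹' {c}) *
          Real.log (ν.real (stripIndex s (ρ / b) ⁻¹' {a} ∩ gridCell ρ ⁻¹' {c}) /
            ν.real (gridCell ρ ⁻¹' {c})) := by
  have := h.isProbabilityMeasure
  have hb' : (0 : ℝ) < b := by exact_mod_cast hb
  have hδ : 0 < ρ / b := div_pos hρ hb'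
  have hmem : ∀ x ∈ E, stripIndex s (ρ / b) x ∈ strips E s (ρ / b) :=
    fun x hx => (mem_strips h.subset_unitSquare hs hδ).2 ⟨x, hx, rfl⟩
  have := sum_mul_log_refine_le (strips E s (ρ / b)) (gridCells E ρ) (strips E s ρ)
    (fun a c => ν.real (stripIndex s (ρ / b) ⁻¹' {a} ∩ gridCell ρ ⁻¹' {c}))
    (fun a => ν.real (stripIndex s (ρ / b) ⁻¹' {a})) (fun c => ν.real (gridCell ρ ⁻¹' {c}))
    (fun a => ν.real (stripIndex s ρ ⁻¹' {a})) (fun a => a / b) 3 (by norm_num)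
    (fun _ _ _ _ => measureReal_nonneg)
    (fun a _ => measureReal_eq_sum_fiber h.measure_compl (measurable_gridCell ρ)
      (gridCells E ρ) (fun x hx => (mem_gridCells h.subset_unitSquare hρ).2 ⟨x, hx, rfl⟩)
      (measurable_stripIndex _ _ (measurableSet_singleton a)))
    (fun c _ => h.measureReal_gridCell_eq_sum hs hδ c)
    (by
      intro a ha
      obtain ⟨x, hx, rfl⟩ := (mem_strips h.subset_unitSquare hs hδ).1 ha
      rw [stripIndex_div s ρ hb]
      exact (mem_strips h.subset_unitSquare hs hρ).2 ⟨x, hx, rfl⟩)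
    (by
      intro c _
      rw [measureReal_eq_sum_fiber h.measure_compl (measurable_stripIndex s (ρ / b))
        (strips E s (ρ / b)) hmem (measurable_stripIndex s ρ (measurableSet_singleton c)),
        Finset.sum_filter]
      refine Finset.sum_congr rfl fun a _ => ?_
      split_ifs with hac
      · congr 1
        refine Set.inter_eq_right.2 fun x hx => ?_
        rw [Set.mem_preimage, Set.mem_singleton_iff] at hx ⊢
        rw [← stripIndex_div s ρ hb, hx, hac]
      · have : stripIndex s ρ ⁻¹' {c} ∩ stripIndex s (ρ / b) ⁻¹' {a} = ∅ := by
          refine Set.eq_empty_of_forall_notMem fun x hx => hac ?_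
          obtain ⟨h1, h2⟩ := hx
          rw [Set.mem_preimage, Set.mem_singleton_iff] at h1 h2
          rw [← h2, stripIndex_div s ρ hb, h1]
        rw [this, measureReal_empty])
    (h.sum_measureReal_strip_eq_one hs hδ)
    -- As `0 ≤ s ≤ 1`, the functional varies by less than `2 * ρ` over a square of side `ρ`; hence
    -- at most three strips.
    (fun c => Finset.Icc ⌊(c.1 : ℝ) + s * c.2⌋ (⌊(c.1 : ℝ) + s * c.2⌋ + 2))
    (by
      intro c _
      rw [Int.card_Icc, show ⌊(c.1 : ℝ) + s * c.2⌋ + 2 + 1 - ⌊(c.1 : ℝ) + s * c.2⌋ = 3 by ring]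
      rfl)
    (by
      intro a _ c _ hne
      obtain ⟨x, h1, h2⟩ : (stripIndex s (ρ / b) ⁻¹' {a} ∩ gridCell ρ ⁻¹' {c}).Nonempty := by
        rw [Set.nonempty_iff_ne_empty]
        intro h0
        simp [h0] at hne
      rw [Set.mem_preimage, Set.mem_singleton_iff] at h1 h2
      rw [← h1, ← h2, stripIndex_div s ρ hb, stripIndex, gridCell, Finset.mem_Icc]
      have e0 := Int.floor_le (x 0 / ρ)
      have e1 := Int.floor_le (x 1 / ρ)
      have f0 := Int.lt_floor_add_one (x 0 / ρ)
      have f1 := Int.lt_floor_add_one (x 1 / ρ)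
      have e : (x 0 + s * x 1) / ρ = x 0 / ρ + s * (x 1 / ρ) := by ring
      have g1 := mul_le_mul_of_nonneg_left e1 hs.1
      have g2 := mul_le_mul_of_nonneg_left f1.le hs.1
      have hs1 := hs.2
      refine ⟨Int.floor_le_floor (by linarith), Int.lt_add_one_iff.1 (Int.floor_lt.2 ?_)⟩
      have := Int.lt_floor_add_one ((⌊x 0 / ρ⌋ : ℝ) + s * (⌊x 1 / ρ⌋ : ℝ))
      push_cast
      linarith)
  simpa only [stripNegEntropy, Nat.cast_ofNat] using this

/-- The constant governing the entropy gained in `m` dyadic scales. -/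
noncomputable def entropyLoss (t K : ℝ) (m : ℕ) : ℝ :=
  288 * K ^ 2 * (m + 1) * ((2 : ℝ) ^ m) ^ (-min t 1)

theorem entropyLoss_pos (h : IsRegularProbability t K E ν) (m : ℕ) : 0 < entropyLoss t K m := by
  have hK : 0 < K := zero_lt_one.trans_le h.one_le
  unfold entropyLoss
  positivity

/-- The entropy gained in `m` dyadic scales, averaged over slopes. -/
theorem sum_stripNegEntropy_step (h : IsRegularProbability t K E ν) (ht2 : t ≤ 2) (m : ℕ) {ρ : ℝ}
    (hρ : 0 < ρ) (hρ1 : ρ ≤ 1) :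
    ∑ j ∈ Finset.range (2 ^ m), stripNegEntropy ν E ((j : ℝ) / (2 ^ m : ℕ)) (ρ / (2 ^ m : ℕ)) ≤
      ∑ j ∈ Finset.range (2 ^ m), stripNegEntropy ν E ((j : ℝ) / (2 ^ m : ℕ)) ρ +
        2 ^ m * Real.log (3 * entropyLoss t K m) := by
  have := h.isProbabilityMeasure
  have hK : 0 < K := zero_lt_one.trans_le h.one_le
  have hM := h.entropyLoss_pos m
  set M := entropyLoss t K m with hMdef
  have hδ : 0 < ρ / (2 ^ m : ℕ) := by positivity
  have hslope : ∀ j ∈ Finset.range (2 ^ m), (j : ℝ) / (2 ^ m : ℕ) ∈ Set.Icc (0 : ℝ) 1 := by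
    intro j hj
    refine ⟨by positivity, div_le_one_of_le₀ ?_ (by positivity)⟩
    exact_mod_cast (Finset.mem_range.1 hj).le
  have step : ∀ j ∈ Finset.range (2 ^ m),
      stripNegEntropy ν E ((j : ℝ) / (2 ^ m : ℕ)) (ρ / (2 ^ m : ℕ)) ≤
      stripNegEntropy ν E ((j : ℝ) / (2 ^ m : ℕ)) ρ +
      ((∑ c ∈ gridCells E ρ, (∑ a ∈ strips E ((j : ℝ) / (2 ^ m : ℕ)) (ρ / (2 ^ m : ℕ)),
        ν.real (stripIndex ((j : ℝ) / (2 ^ m : ℕ)) (ρ / (2 ^ m : ℕ)) ⁻¹' {a} ∩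
          gridCell ρ ⁻¹' {c}) ^ 2) / ν.real (gridCell ρ ⁻¹' {c})) / M +
        (Real.log 3 + Real.log M - 1)) := by
    intro j hj
    have h1 := h.stripNegEntropy_refine_le (hslope j hj) hρ (b := 2 ^ m) (by positivity)
    have h2 := sum_mul_log_div_le (strips E ((j : ℝ) / (2 ^ m : ℕ)) (ρ / (2 ^ m : ℕ)))
      (gridCells E ρ) (fun a c =>
        ν.real (stripIndex ((j : ℝ) / (2 ^ m : ℕ)) (ρ / (2 ^ m : ℕ)) ⁻¹' {a} ∩
          gridCell ρ ⁻¹' {c})) (fun c => ν.real (gridCell ρ ⁻¹' {c}))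
      (fun _ _ _ _ => measureReal_nonneg)
      (fun c _ => h.measureReal_gridCell_eq_sum (hslope j hj) hδ c)
      (h.sum_measureReal_gridCell_eq_one hρ) hM
    linarith
  refine (Finset.sum_le_sum step).trans ?_
  rw [Finset.sum_add_distrib, Finset.sum_add_distrib, ← Finset.sum_div, Finset.sum_comm,
    Finset.sum_const, Finset.card_range, nsmul_eq_mul, Real.log_mul three_ne_zero hM.ne']
  simp only [← Finset.sum_div]
  -- The factor `ρ ^ t` cancels against the `9 * K * ρ ^ (-t)` squares, so the bound is independent
  -- of the scale; 288 is 32 times 9.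
  have hcells : ∑ c ∈ gridCells E ρ, (∑ j ∈ Finset.range (2 ^ m),
      ∑ a ∈ strips E ((j : ℝ) / (2 ^ m : ℕ)) (ρ / (2 ^ m : ℕ)),
        ν.real (stripIndex ((j : ℝ) / (2 ^ m : ℕ)) (ρ / (2 ^ m : ℕ)) ⁻¹' {a} ∩
          gridCell ρ ⁻¹' {c}) ^ 2) / ν.real (gridCell ρ ⁻¹' {c}) ≤ 2 ^ m * M := by
    calc _ ≤ ∑ c ∈ gridCells E ρ, 32 * K * (m + 1) * ((2 : ℝ) ^ m) ^ (1 - min t 1) * ρ ^ t :=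
          Finset.sum_le_sum fun c _ => div_le_of_le_mul₀ measureReal_nonneg (by positivity)
            (h.sum_sq_measureReal_le ht2 m hρ c)
      _ = 32 * K * (m + 1) * ((2 : ℝ) ^ m) ^ (1 - min t 1) *
            ((gridCells E ρ).card * ρ ^ t) := by
          rw [Finset.sum_const, nsmul_eq_mul]; ring
      _ ≤ 32 * K * (m + 1) * ((2 : ℝ) ^ m) ^ (1 - min t 1) * (9 * K) :=
          mul_le_mul_of_nonneg_left (h.card_gridCells_le hρ hρ1) (by positivity)
      _ = 2 ^ m * M := by
          rw [hMdef, entropyLoss, sub_eq_add_neg, Real.rpow_add (by positivity), Real.rpow_one]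
          ring
  -- This `2 ^ m` is cancelled by the `-1` of the tangent bound, summed over the slopes.
  have h3 : (∑ c ∈ gridCells E ρ, (∑ j ∈ Finset.range (2 ^ m),
      ∑ a ∈ strips E ((j : ℝ) / (2 ^ m : ℕ)) (ρ / (2 ^ m : ℕ)),
        ν.real (stripIndex ((j : ℝ) / (2 ^ m : ℕ)) (ρ / (2 ^ m : ℕ)) ⁻¹' {a} ∩
          gridCell ρ ⁻¹' {c}) ^ 2) / ν.real (gridCell ρ ⁻¹' {c})) / M ≤ 2 ^ m := by
    rwa [div_le_iff₀ hM]
  push_cast at h3 ⊢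
  linarith

/-- The one-step gains telescope; at width 1 the negative entropy is at most 0. -/
theorem sum_stripNegEntropy_le (h : IsRegularProbability t K E ν) (ht2 : t ≤ 2) (m n : ℕ) :
    ∑ j ∈ Finset.range (2 ^ m),
      stripNegEntropy ν E ((j : ℝ) / (2 ^ m : ℕ)) (1 / ((2 ^ m : ℕ) : ℝ) ^ n) ≤
      n * (2 ^ m * Real.log (3 * entropyLoss t K m)) := by
  have := h.isProbabilityMeasure
  induction n with
  | zero =>
    simp only [pow_zero, Nat.cast_zero, zero_mul]
    refine Finset.sum_nonpos fun j _ => Finset.sum_nonpos fun a _ => ?_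
    exact mul_nonpos_of_nonneg_of_nonpos measureReal_nonneg
      (Real.log_nonpos measureReal_nonneg measureReal_le_one)
  | succ n ih =>
    have hb : (1 : ℝ) ≤ (2 ^ m : ℕ) := by exact_mod_cast Nat.one_le_two_pow
    have := h.sum_stripNegEntropy_step ht2 m (ρ := 1 / ((2 ^ m : ℕ) : ℝ) ^ n) (by positivity)
      (div_le_one_of_le₀ (one_le_pow₀ hb) (by positivity))
    rw [div_div, ← pow_succ] at this
    push_cast at this ih ⊢
    linarith

/-- At every scale some slope has many strips meeting `E`. -/
theorem exists_slope_log_card_strips_ge (h : IsRegularProbability t K E ν) (ht2 : t ≤ 2)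
    (m n : ℕ) : ∃ j ∈ Finset.range (2 ^ m), -(n * Real.log (3 * entropyLoss t K m)) ≤
      Real.log (strips E ((j : ℝ) / (2 ^ m : ℕ)) (1 / ((2 ^ m : ℕ) : ℝ) ^ n)).card := by
  obtain ⟨j, hj, hle⟩ := Finset.exists_le_of_sum_le (s := Finset.range (2 ^ m))
    (f := fun j : ℕ => stripNegEntropy ν E ((j : ℝ) / (2 ^ m : ℕ)) (1 / ((2 ^ m : ℕ) : ℝ) ^ n))
    (g := fun _ => n * Real.log (3 * entropyLoss t K m)) (by simp) (by
      refine (h.sum_stripNegEntropy_le ht2 m n).trans_eq ?_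
      rw [Finset.sum_const, Finset.card_range, nsmul_eq_mul]
      push_cast
      ring)
  refine ⟨j, hj, ?_⟩
  have hslope : (j : ℝ) / (2 ^ m : ℕ) ∈ Set.Icc (0 : ℝ) 1 := by
    refine ⟨by positivity, div_le_one_of_le₀ ?_ (by positivity)⟩
    exact_mod_cast (Finset.mem_range.1 hj).le
  have := neg_sum_mul_log_le_log_card
    (strips E ((j : ℝ) / (2 ^ m : ℕ)) (1 / ((2 ^ m : ℕ) : ℝ) ^ n)) _
    (fun _ _ => measureReal_nonneg)
    (h.sum_measureReal_strip_eq_one hslope (by positivity))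
  rw [stripNegEntropy] at hle
  linarith

end IsRegularProbability

/-! ### Box counting and the upper bound -/

theorem Real.tendsto_neg_log_nhdsGT_zero :
    Filter.Tendsto (fun δ : ℝ => -Real.log δ) (nhdsWithin 0 (Set.Ioi 0)) Filter.atTop :=
  Filter.tendsto_neg_atBot_atTop.comp Real.tendsto_log_nhdsGT_zero

/-- Kept as a membership because `sInf ∅ = 0` in `ℕ`: extracting an optimal cover requires knowing
that a finite one exists. -/
theorem boxCount_mem_of_cover {X ι : Type*} [PseudoMetricSpace X] {F : Set X} {δ : ℝ}
    (S : Finset ι) (U : ι → Set X) (hU : ∀ i ∈ S, Metric.ediam (U i) ≤ ENNReal.ofReal δ)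
    (hF : ∀ x ∈ F, ∃ i ∈ S, x ∈ U i) :
    S.card ∈ {k : ℕ | ∃ U : Fin k → Set X,
      F ⊆ ⋃ i, U i ∧ ∀ i, Metric.ediam (U i) ≤ ENNReal.ofReal δ} := by
  refine ⟨fun i => U (S.equivFin.symm i), fun x hx => ?_, fun i => hU _ (S.equivFin.symm i).2⟩
  obtain ⟨i, hi, hxi⟩ := hF x hx
  exact Set.mem_iUnion.2 ⟨S.equivFin ⟨i, hi⟩, by simpa using hxi⟩

theorem boxCount_le_of_cover {X ι : Type*} [PseudoMetricSpace X] {F : Set X} {δ : ℝ}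
    (S : Finset ι) (U : ι → Set X) (hU : ∀ i ∈ S, Metric.ediam (U i) ≤ ENNReal.ofReal δ)
    (hF : ∀ x ∈ F, ∃ i ∈ S, x ∈ U i) : boxCount F δ ≤ S.card :=
  Nat.sInf_le (boxCount_mem_of_cover S U hU hF)

theorem upperBoxDim_le_of_boxCount_le {X : Type*} [PseudoMetricSpace X] {F : Set X} {u C : ℝ}
    (hu : 0 ≤ u) (hC : 1 ≤ C)
    (h : ∀ δ : ℝ, 0 < δ → δ < 1 → (boxCount F δ : ℝ) * δ ^ u ≤ C) :
    upperBoxDim F ≤ (u : EReal) := by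
  have hlim : Filter.Tendsto (fun δ : ℝ => ((Real.log C / (-Real.log δ) + u : ℝ) : EReal))
      (nhdsWithin 0 (Set.Ioi 0)) (nhds (u : EReal)) := by
    refine (continuous_coe_real_ereal.tendsto u).comp ?_
    simpa using (Real.tendsto_neg_log_nhdsGT_zero.const_div_atTop (Real.log C)).add_const u
  rw [← hlim.limsup_eq]
  refine Filter.limsup_le_limsup ?_
  have : Set.Ioo (0 : ℝ) 1 ∈ nhdsWithin (0 : ℝ) (Set.Ioi 0) := Ioo_mem_nhdsGT zero_lt_one
  filter_upwards [this] with δ hδ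
  rw [EReal.coe_le_coe_iff]
  have hl : 0 < -Real.log δ := neg_pos.2 (Real.log_neg hδ.1 hδ.2)
  rw [div_add' _ _ _ hl.ne', div_le_div_iff_of_pos_right hl]
  rcases Nat.eq_zero_or_pos (boxCount F δ) with h0 | h0
  · rw [h0, Nat.cast_zero, Real.log_zero]
    have := Real.log_nonneg hC
    positivity
  · have hb : (0 : ℝ) < boxCount F δ := by exact_mod_cast h0
    have hp := Real.rpow_pos_of_pos hδ.1 u
    have := Real.log_le_log (by positivity) (h δ hδ.1 hδ.2)
    rw [Real.log_mul hb.ne' hp.ne', Real.log_rpow hδ.1] at this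
    linarith

theorem lineProj_eq_inner_smul {e : EuclideanSpace ℝ (Fin 2)} (he : ‖e‖ = 1)
    (x : EuclideanSpace ℝ (Fin 2)) : lineProj e x = (inner ℝ e x) • e :=
  Submodule.starProjection_unit_singleton ℝ he x

theorem dist_lineProj {e : EuclideanSpace ℝ (Fin 2)} (he : ‖e‖ = 1)
    (x y : EuclideanSpace ℝ (Fin 2)) :
    dist (lineProj e x) (lineProj e y) = |inner ℝ e x - inner ℝ e y| := by
  rw [lineProj_eq_inner_smul he, lineProj_eq_inner_smul he, dist_eq_norm, ← sub_smul, norm_smul,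
    he, mul_one, Real.norm_eq_abs]

theorem dist_lineProj_le {e : EuclideanSpace ℝ (Fin 2)} (he : ‖e‖ = 1)
    (x y : EuclideanSpace ℝ (Fin 2)) : dist (lineProj e x) (lineProj e y) ≤ dist x y := by
  rw [dist_lineProj he, ← inner_sub_right, dist_eq_norm]
  simpa [he] using abs_real_inner_le_norm e (x - y)

theorem ediam_lineProj_image_le {e : EuclideanSpace ℝ (Fin 2)} {A : Set (EuclideanSpace ℝ (Fin 2))}
    {δ : ℝ} (h : ∀ x ∈ A, ∀ y ∈ A, dist (lineProj e x) (lineProj e y) ≤ δ) :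
    Metric.ediam (lineProj e '' A) ≤ ENNReal.ofReal δ := by
  refine Metric.ediam_le ?_
  rintro _ ⟨x, hx, rfl⟩ _ ⟨y, hy, rfl⟩
  rw [edist_dist]
  exact ENNReal.ofReal_le_ofReal (h x hx y hy)

/-- The projections of the squares of the grid cover the projection of a set. -/
theorem card_gridCells_mem_covers {E : Set (EuclideanSpace ℝ (Fin 2))} (hE : E ⊆ unitSquare)
    {e : EuclideanSpace ℝ (Fin 2)} (he : ‖e‖ = 1) {δ : ℝ} (hδ : 0 < δ) :
    (gridCells E (δ / 2)).card ∈ {k : ℕ | ∃ U : Fin k → Set (EuclideanSpace ℝ (Fin 2)),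
      lineProj e '' E ⊆ ⋃ i, U i ∧ ∀ i, Metric.ediam (U i) ≤ ENNReal.ofReal δ} := by
  refine boxCount_mem_of_cover _ (fun c => lineProj e '' (gridCell (δ / 2) ⁻¹' {c})) ?_ ?_
  · refine fun c _ => ediam_lineProj_image_le fun x hx y hy => (dist_lineProj_le he x y).trans ?_
    refine (dist_le_of_gridCell_eq (half_pos hδ) ?_).trans_eq (by ring)
    rw [Set.mem_preimage, Set.mem_singleton_iff] at hx hy
    rw [hx, hy]
  · rintro _ ⟨x, hx, rfl⟩
    exact ⟨gridCell (δ / 2) x, (mem_gridCells hE (half_pos hδ)).2 ⟨x, hx, rfl⟩,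
      Set.mem_image_of_mem _ rfl⟩

theorem upperBoxDim_lineProj_le_one {E : Set (EuclideanSpace ℝ (Fin 2))} (hE : E ⊆ unitSquare)
    {e : EuclideanSpace ℝ (Fin 2)} (he : ‖e‖ = 1) :
    upperBoxDim (lineProj e '' E) ≤ ((1 : ℝ) : EReal) := by
  refine upperBoxDim_le_of_boxCount_le (C := 6) zero_le_one (by norm_num) fun δ hδ hδ1 => ?_
  have h1 : boxCount (lineProj e '' E) δ ≤ (Finset.Icc ⌊-2 / δ⌋ ⌊2 / δ⌋).card := by
    refine boxCount_le_of_cover _ (fun a => lineProj e '' {x | ⌊inner ℝ e x / δ⌋ = a}) ?_ ?_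
    · refine fun a _ => ediam_lineProj_image_le fun x hx y hy => ?_
      rw [dist_lineProj he]
      rw [Set.mem_ofPred_eq] at hx hy
      exact (abs_sub_lt_of_floor_div_eq hδ (hx.trans hy.symm)).le
    · rintro _ ⟨x, hx, rfl⟩
      refine ⟨⌊inner ℝ e x / δ⌋, ?_, Set.mem_image_of_mem _ rfl⟩
      have hx2 : ‖x‖ ≤ 2 := by
        have h0 := hE hx 0
        have h1 := hE hx 1
        have := dist_le_add_abs x 0
        simp only [dist_zero_right, PiLp.zero_apply, sub_zero, abs_of_nonneg h0.1,
          abs_of_nonneg h1.1] at this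
        linarith [h0.2, h1.2]
      have := abs_real_inner_le_norm e x
      rw [he, one_mul] at this
      have := abs_le.1 (this.trans hx2)
      rw [Finset.mem_Icc]
      exact ⟨Int.floor_le_floor (div_le_div_of_nonneg_right this.1 hδ.le),
        Int.floor_le_floor (div_le_div_of_nonneg_right this.2 hδ.le)⟩
  rw [Int.card_Icc] at h1
  have h2 : (boxCount (lineProj e '' E) δ : ℝ) ≤ 4 / δ + 2 := by
    have h3 : 0 ≤ ⌊2 / δ⌋ + 1 - ⌊-2 / δ⌋ := by
      have : ⌊-2 / δ⌋ ≤ ⌊2 / δ⌋ :=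
        Int.floor_le_floor (div_le_div_of_nonneg_right (by norm_num) hδ.le)
      omega
    have h4 : ((boxCount (lineProj e '' E) δ : ℕ) : ℤ) ≤ ⌊2 / δ⌋ + 1 - ⌊-2 / δ⌋ := by
      rw [← Int.toNat_of_nonneg h3]
      exact_mod_cast h1
    have h5 : ((boxCount (lineProj e '' E) δ : ℕ) : ℝ) ≤ ⌊2 / δ⌋ + 1 - ⌊-2 / δ⌋ := by
      exact_mod_cast h4
    have h6 : -2 / δ = -(2 / δ) := by ring
    have h7 : 4 / δ = 2 * (2 / δ) := by ring
    linarith [Int.floor_le (2 / δ), Int.lt_floor_add_one (-2 / δ)]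
  rw [Real.rpow_one]
  calc _ ≤ (4 / δ + 2) * δ := mul_le_mul_of_nonneg_right h2 hδ.le
    _ = 4 + 2 * δ := by field_simp
    _ ≤ 6 := by linarith

/-- Squares of side `δ / 2` have diameter at most `δ`, so do their projections, and there are at
most a constant times `δ ^ (-t)` of them. -/
theorem IsRegularProbability.upperBoxDim_lineProj_le {t K : ℝ}
    {E : Set (EuclideanSpace ℝ (Fin 2))} {ν : Measure (EuclideanSpace ℝ (Fin 2))}
    (h : IsRegularProbability t K E ν) (ht : 0 < t) {e : EuclideanSpace ℝ (Fin 2)}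
    (he : ‖e‖ = 1) : upperBoxDim (lineProj e '' E) ≤ (t : EReal) := by
  have hK := h.one_le
  have h2t : (1 : ℝ) ≤ 2 ^ t := Real.one_le_rpow one_le_two ht.le
  refine upperBoxDim_le_of_boxCount_le (C := 9 * K * 2 ^ t) ht.le (by nlinarith)
    fun δ hδ hδ1 => ?_
  have h1 : boxCount (lineProj e '' E) δ ≤ (gridCells E (δ / 2)).card :=
    Nat.sInf_le (card_gridCells_mem_covers h.subset_unitSquare he hδ)
  have h2 := h.card_gridCells_le (half_pos hδ) (by linarith)
  rw [Real.div_rpow hδ.le zero_le_two, ← mul_div_assoc, div_le_iff₀ (by positivity)] at h2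
  refine le_trans (mul_le_mul_of_nonneg_right ?_ (Real.rpow_pos_of_pos hδ t).le) h2
  exact_mod_cast h1

/-! ### From strips to covers of projections -/

/-- The unit vector in the direction `(1, s)`. -/
noncomputable def slopeDir (s : ℝ) : EuclideanSpace ℝ (Fin 2) :=
  (√(1 + s ^ 2))⁻¹ • !₂[1, s]

theorem norm_slopeDir (s : ℝ) : ‖slopeDir s‖ = 1 := by
  have h : (0 : ℝ) < √(1 + s ^ 2) := Real.sqrt_pos.2 (by positivity)
  rw [slopeDir, norm_smul, EuclideanSpace.norm_eq, Fin.sum_univ_two]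
  simp [abs_of_pos h, h.ne']

theorem sqrt_mul_inner_slopeDir (s : ℝ) (x : EuclideanSpace ℝ (Fin 2)) :
    √(1 + s ^ 2) * inner ℝ (slopeDir s) x = x 0 + s * x 1 := by
  have h : (0 : ℝ) < √(1 + s ^ 2) := Real.sqrt_pos.2 (by positivity)
  rw [slopeDir, real_inner_smul_left, mul_inv_cancel_left₀ h.ne', PiLp.inner_apply,
    Fin.sum_univ_two]
  simp [mul_comm]

/-- A set of diameter at most half the width of the strips meets at most two of them. -/
theorem card_strips_le_two_mul_boxCount {E : Set (EuclideanSpace ℝ (Fin 2))}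
    (hE : E ⊆ unitSquare) {s ρ : ℝ} (hs : s ∈ Set.Icc (0 : ℝ) 1) (hρ : 0 < ρ) :
    (strips E s ρ).card ≤ 2 * boxCount (lineProj (slopeDir s) '' E) (ρ / 2) := by
  obtain ⟨U, hcov, hU⟩ := Nat.sInf_mem (s := {k : ℕ | ∃ U : Fin k → Set (EuclideanSpace ℝ (Fin 2)),
      lineProj (slopeDir s) '' E ⊆ ⋃ i, U i ∧ ∀ i, Metric.ediam (U i) ≤ ENNReal.ofReal (ρ / 2)})
    ⟨_, card_gridCells_mem_covers hE (norm_slopeDir s) (half_pos hρ)⟩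
  change Fin (boxCount (lineProj (slopeDir s) '' E) (ρ / 2)) → _ at U
  have hx : ∀ a ∈ strips E s ρ, ∃ (x : EuclideanSpace ℝ (Fin 2))
      (i : Fin (boxCount (lineProj (slopeDir s) '' E) (ρ / 2))),
      stripIndex s ρ x = a ∧ lineProj (slopeDir s) x ∈ U i := by
    intro a ha
    obtain ⟨x, hx, hxa⟩ := (mem_strips hE hs hρ).1 ha
    obtain ⟨i, hi⟩ := Set.mem_iUnion.1 (hcov (Set.mem_image_of_mem _ hx))
    exact ⟨x, i, hxa, hi⟩
  rcases (strips E s ρ).eq_empty_or_nonempty with h0 | ⟨a₀, ha₀⟩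
  · simp [h0]
  have : Nonempty (Fin (boxCount (lineProj (slopeDir s) '' E) (ρ / 2))) :=
    ⟨(hx a₀ ha₀).choose_spec.choose⟩
  choose! x i hxa hxi using hx
  -- Indices of strips meeting the same covering set differ by at most 1, so the covering set and
  -- the parity determine the strip.
  have hcard := Finset.card_le_card_of_injOn (s := strips E s ρ)
    (t := (Finset.univ : Finset (Fin (boxCount (lineProj (slopeDir s) '' E) (ρ / 2)))) ×ˢ
      Finset.Icc (0 : ℤ) 1) (fun a => (i a, a % 2))
    (fun a _ => by
      simp only [Finset.coe_product, Finset.coe_univ, Set.mem_prod, Set.mem_univ, true_and,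
        Finset.coe_Icc, Set.mem_Icc]
      omega)
    (fun a ha b hb hab => by
      obtain ⟨h1, h2⟩ := Prod.mk.inj hab
      have hd : dist (lineProj (slopeDir s) (x a)) (lineProj (slopeDir s) (x b)) ≤ ρ / 2 := by
        have h3 := (Metric.edist_le_ediam_of_mem (hxi a ha) (h1 ▸ hxi b hb)).trans (hU (i a))
        rw [edist_dist] at h3
        exact (ENNReal.ofReal_le_ofReal_iff (half_pos hρ).le).1 h3
      rw [dist_lineProj (norm_slopeDir s)] at hd
      have hsq : √(1 + s ^ 2) ≤ 2 := by
        rw [Real.sqrt_le_left zero_le_two]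
        nlinarith [hs.1, hs.2]
      have hclose : |(x a 0 + s * x a 1) - (x b 0 + s * x b 1)| ≤ ρ := by
        rw [← sqrt_mul_inner_slopeDir, ← sqrt_mul_inner_slopeDir, ← mul_sub, abs_mul,
          abs_of_nonneg (Real.sqrt_nonneg _)]
        calc _ ≤ 2 * (ρ / 2) := mul_le_mul hsq hd (abs_nonneg _) zero_le_two
          _ = ρ := by ring
      have h4 := abs_le.1 (abs_floor_div_sub_le_one hρ hclose)
      have h5 := hxa a ha
      have h6 := hxa b hb
      rw [stripIndex] at h5 h6
      rw [h5, h6] at h4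
      omega)
  rw [Finset.card_product, Finset.card_univ, Fintype.card_fin, Int.card_Icc] at hcard
  simpa [mul_comm] using hcard

/-! ### Normalising the measure -/

/-- An Ahlfors-David regular subset of the unit square carries a regular probability measure
whose lower bound holds at all scales up to `1`. -/
theorem IsADRegularSet.exists_isRegularProbability {t : ℝ} (ht : 0 < t)
    {E : Set (EuclideanSpace ℝ (Fin 2))} (hE : E ⊆ unitSquare) (hnt : E.Nontrivial)
    (h : IsADRegularSet t E) : ∃ K ν, IsRegularProbability t K E ν := by
  obtain ⟨C, hC, μ, hμE, hsub, hreg⟩ := h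
  have hbdd : Bornology.IsBounded E := by
    refine Metric.isBounded_iff.2 ⟨2, fun x hx y hy => ?_⟩
    have e (i : Fin 2) : |x i - y i| ≤ 1 :=
      abs_le.2 ⟨by linarith [(hE hx i).1, (hE hy i).2], by linarith [(hE hx i).2, (hE hy i).1]⟩
    linarith [dist_le_add_abs x y, e 0, e 1]
  have hsupp : μ.support ⊆ closure E :=
    Measure.support_subset_of_isClosed isClosed_closure
      (Filter.mem_of_superset (by rwa [mem_ae_iff]) subset_closure)
  have hfin : Metric.ediam μ.support ≠ ⊤ :=
    (Metric.isBounded_iff_ediam_ne_top.1 (hbdd.closure.subset hsupp))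
  obtain ⟨x₀, hx₀, y₀, hy₀, hxy⟩ := hnt
  set D := (Metric.ediam μ.support).toReal with hD
  have hDe : ENNReal.ofReal D = Metric.ediam μ.support := ENNReal.ofReal_toReal hfin
  have hdist : ∀ x ∈ E, ∀ y ∈ E, dist x y ≤ D := by
    intro x hx y hy
    have := Metric.edist_le_ediam_of_mem (hsub hx) (hsub hy)
    rw [← hDe, edist_dist] at this
    exact (ENNReal.ofReal_le_ofReal_iff ENNReal.toReal_nonneg).1 this
  have hD0 : 0 < D := (dist_pos.2 hxy).trans_le (hdist _ hx₀ _ hy₀)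
  have hball : ∀ x ∈ E, ∀ r, D ≤ r → μ (Metric.closedBall x r) = μ Set.univ := by
    intro x hx r hr
    refine measure_congr (Filter.eventuallyEq_univ.2 (Filter.mem_of_superset (x := E) ?_ ?_))
    · rwa [mem_ae_iff]
    · exact fun y hy => Metric.mem_closedBall.2 ((hdist y hy x hx).trans hr)
  obtain ⟨hlow, hup⟩ := hreg x₀ (hsub hx₀) D hD0 hDe.le
  rw [hball x₀ hx₀ D le_rfl] at hlow hup
  have hDt : 0 < D ^ t := Real.rpow_pos_of_pos hD0 t
  have : IsFiniteMeasure μ := ⟨hup.trans_lt ENNReal.ofReal_lt_top⟩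
  have : NeZero μ := ⟨fun h0 => by
    rw [h0] at hlow
    simp only [Measure.coe_zero, Pi.zero_apply, nonpos_iff_eq_zero, ENNReal.ofReal_eq_zero]
      at hlow
    exact absurd (div_pos hDt hC) hlow.not_gt⟩
  set M := μ.real Set.univ with hM
  have hM0 : 0 < M := measureReal_univ_pos
  have hν : ∀ s, ((μ Set.univ)⁻¹ • μ).real s = μ.real s / M := by
    intro s
    rw [measureReal_ennreal_smul_apply, ENNReal.toReal_inv, hM, div_eq_inv_mul]
    rfl
  -- `C / M` and `C * M` serve radii below `D`. Balls of radius at least `D` have full mass: there 1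
  -- gives the lower bound and `(D ^ t)⁻¹` the upper one.
  set K := max (max (C / M) (C * M)) (max 1 ((D ^ t)⁻¹)) with hK
  have hK1 : C / M ≤ K := (le_max_left _ _).trans (le_max_left _ _)
  have hK2 : C * M ≤ K := (le_max_right _ _).trans (le_max_left _ _)
  have hK3 : 1 ≤ K := (le_max_left _ _).trans (le_max_right _ _)
  have hK4 : (D ^ t)⁻¹ ≤ K := (le_max_right _ _).trans (le_max_right _ _)
  have hK0 : 0 < K := zero_lt_one.trans_le hK3
  have hprob : IsProbabilityMeasure ((μ Set.univ)⁻¹ • μ) := inferInstance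
  refine ⟨K, (μ Set.univ)⁻¹ • μ, hprob, hE, hK3, by simp [hμE], fun x hx r hr hr1 => ?_,
    fun x hx r hr => ?_⟩
  · rw [hν]
    have hrt : 0 < r ^ t := Real.rpow_pos_of_pos hr t
    rcases le_total r D with hrD | hrD
    · have h1 := (hreg x (hsub hx) r hr (hDe ▸ ENNReal.ofReal_le_ofReal hrD)).1
      rw [ENNReal.ofReal_le_iff_le_toReal (measure_ne_top μ _)] at h1
      calc r ^ t / K ≤ r ^ t / (C * M) := div_le_div_of_nonneg_left hrt.le (by positivity) hK2
        _ = r ^ t / C / M := (div_div _ _ _).symm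
        _ ≤ _ := div_le_div_of_nonneg_right h1 hM0.le
    · rw [measureReal_def, hball x hx r hrD, ← measureReal_def, div_self hM0.ne']
      rw [div_le_one hK0]
      exact (Real.rpow_le_one hr.le hr1 ht.le).trans hK3
  · rcases le_total r D with hrD | hrD
    · have hrt : 0 < r ^ t := Real.rpow_pos_of_pos hr t
      have h1 := (hreg x (hsub hx) r hr (hDe ▸ ENNReal.ofReal_le_ofReal hrD)).2
      have h2 := ENNReal.toReal_le_of_le_ofReal (by positivity) h1
      rw [hν]
      calc _ ≤ C * r ^ t / M := div_le_div_of_nonneg_right h2 hM0.le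
        _ = C / M * r ^ t := by ring
        _ ≤ K * r ^ t := mul_le_mul_of_nonneg_right hK1 hrt.le
    · refine measureReal_le_one.trans ?_
      calc 1 = (D ^ t)⁻¹ * D ^ t := (inv_mul_cancel₀ hDt.ne').symm
        _ ≤ K * r ^ t := mul_le_mul hK4 (Real.rpow_le_rpow hD0.le hrD ht.le) hDt.le hK0.le

/-! ### Choice of scale and conclusion -/

/-- The quantity equals `864 * K ^ 2 * (m + 1) * r ^ m` with `r = 2 ^ (σ - min t 1) < 1`, so the
geometric decay beats all losses. -/
theorem exists_entropyLoss_lt (t K : ℝ) {σ : ℝ} (hσ : σ < min t 1) :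
    ∃ m : ℕ, 0 < m ∧ 3 * IsRegularProbability.entropyLoss t K m * ((2 : ℝ) ^ m) ^ σ < 1 := by
  set r : ℝ := 2 ^ (σ - min t 1) with hr
  have hr0 : 0 ≤ r := by positivity
  have hr1 : r < 1 := Real.rpow_lt_one_of_one_lt_of_neg one_lt_two (by linarith)
  have hlim : Filter.Tendsto (fun m : ℕ => 864 * K ^ 2 * (m * r ^ m + r ^ m)) Filter.atTop
      (nhds (864 * K ^ 2 * (0 + 0))) :=
    ((tendsto_self_mul_const_pow_of_lt_one hr0 hr1).add
      (tendsto_pow_atTop_nhds_zero_of_lt_one hr0 hr1)).const_mul _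
  rw [add_zero, mul_zero] at hlim
  obtain ⟨m, hm, hm0⟩ := ((hlim.eventually_lt_const zero_lt_one).and
    (Filter.eventually_gt_atTop 0)).exists
  refine ⟨m, hm0, ?_⟩
  have : r ^ m = ((2 : ℝ) ^ m) ^ (-min t 1) * ((2 : ℝ) ^ m) ^ σ := by
    rw [hr, ← Real.rpow_add (by positivity), ← Real.rpow_natCast, ← Real.rpow_natCast,
      ← Real.rpow_mul zero_le_two, ← Real.rpow_mul zero_le_two]
    congr 1
    ring
  refine lt_of_eq_of_lt ?_ hm
  rw [this, IsRegularProbability.entropyLoss]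
  ring

/-- Some dyadic slope gives a projection of upper box dimension at least `σ`, for each
`σ < min t 1`. -/
theorem IsRegularProbability.exists_slope_upperBoxDim_ge {t K : ℝ}
    {E : Set (EuclideanSpace ℝ (Fin 2))} {ν : Measure (EuclideanSpace ℝ (Fin 2))}
    (h : IsRegularProbability t K E ν) (ht2 : t ≤ 2) {σ : ℝ} (hσ : σ < min t 1) :
    ∃ m j : ℕ, (σ : EReal) ≤
      upperBoxDim (lineProj (slopeDir ((j : ℝ) / (2 ^ m : ℕ))) '' E) := by
  obtain ⟨m, hm0, hm⟩ := exists_entropyLoss_lt t K hσ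
  set c := -Real.log (3 * entropyLoss t K m) with hc
  have hM := h.entropyLoss_pos m
  have hm0' : (0 : ℝ) < m := by exact_mod_cast hm0
  have hlog2 : 0 < Real.log 2 := Real.log_pos one_lt_two
  have hcσ : σ * (m * Real.log 2) < c := by
    have := Real.log_neg (by positivity) hm
    rw [Real.log_mul (by positivity) (by positivity), Real.log_rpow (by positivity),
      Real.log_pow] at this
    linarith
  -- Pigeonhole: the good slope depends on `n`, but only `2 ^ m` are available, so one recurs
  -- infinitely often.
  obtain ⟨j, hj, hfreq⟩ : ∃ j ∈ Finset.range (2 ^ m), ∃ᶠ n : ℕ in Filter.atTop,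
      n * c ≤ Real.log
        (strips E ((j : ℝ) / (2 ^ m : ℕ)) (1 / ((2 ^ m : ℕ) : ℝ) ^ n)).card := by
    by_contra! hcon
    obtain ⟨n, hn⟩ := ((Filter.eventually_all_finset _).2 hcon).exists
    obtain ⟨j, hj, hle⟩ := h.exists_slope_log_card_strips_ge ht2 m n
    linarith [hn j hj]
  refine ⟨m, j, Filter.le_limsup_of_frequently_le ?_⟩
  have hb : (1 : ℝ) < (2 ^ m : ℕ) := by exact_mod_cast Nat.one_lt_two_pow hm0.ne'
  have hlim : Filter.Tendsto (fun n : ℕ => 1 / ((2 ^ m : ℕ) : ℝ) ^ n / 2) Filter.atTop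
      (nhdsWithin 0 (Set.Ioi 0)) := by
    refine tendsto_nhdsWithin_iff.2 ⟨?_, Filter.Eventually.of_forall fun n => ?_⟩
    · have := (tendsto_pow_atTop_nhds_zero_of_lt_one (r := 1 / ((2 ^ m : ℕ) : ℝ))
        (by positivity) ((div_lt_one (by positivity)).2 hb)).div_const 2
      simpa only [one_div, inv_pow, zero_div] using this
    · rw [Set.mem_Ioi]
      positivity
  refine hlim.frequently ?_
  -- Absorbs the factor 2 between strips and covering sets and the halved scale, which together cost
  -- `(σ + 1) * Real.log 2`.
  have hlarge : ∀ᶠ n : ℕ in Filter.atTop,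
      (σ + 1) * Real.log 2 ≤ n * (c - σ * (m * Real.log 2)) :=
    (tendsto_natCast_atTop_atTop.atTop_mul_const (sub_pos.2 hcσ)).eventually_ge_atTop _
  refine (hfreq.and_eventually hlarge).mono fun n hn => ?_
  obtain ⟨h1, h2⟩ := hn
  rw [EReal.coe_le_coe_iff]
  have hslope : (j : ℝ) / (2 ^ m : ℕ) ∈ Set.Icc (0 : ℝ) 1 := by
    refine ⟨by positivity, div_le_one_of_le₀ ?_ (by positivity)⟩
    exact_mod_cast (Finset.mem_range.1 hj).le
  have hρ : (0 : ℝ) < 1 / ((2 ^ m : ℕ) : ℝ) ^ n := by positivity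
  have hcount := card_strips_le_two_mul_boxCount h.subset_unitSquare hslope hρ
  have hpos : 0 < (strips E ((j : ℝ) / (2 ^ m : ℕ)) (1 / ((2 ^ m : ℕ) : ℝ) ^ n)).card := by
    rw [Finset.card_pos, Finset.nonempty_iff_ne_empty]
    intro h0
    have := h.sum_measureReal_strip_eq_one hslope hρ
    rw [h0] at this
    simp at this
  have hbpos : 0 < boxCount (lineProj (slopeDir ((j : ℝ) / (2 ^ m : ℕ))) '' E)
      (1 / ((2 ^ m : ℕ) : ℝ) ^ n / 2) := by omega
  have hlogs : Real.log
      (strips E ((j : ℝ) / (2 ^ m : ℕ)) (1 / ((2 ^ m : ℕ) : ℝ) ^ n)).card ≤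
      Real.log 2 + Real.log (boxCount (lineProj (slopeDir ((j : ℝ) / (2 ^ m : ℕ))) '' E)
        (1 / ((2 ^ m : ℕ) : ℝ) ^ n / 2)) := by
    rw [← Real.log_mul two_ne_zero (by exact_mod_cast hbpos.ne')]
    exact Real.log_le_log (by exact_mod_cast hpos) (by exact_mod_cast hcount)
  have hδ : -Real.log (1 / ((2 ^ m : ℕ) : ℝ) ^ n / 2) = (n * m + 1) * Real.log 2 := by
    rw [div_div, Real.log_div one_ne_zero (by positivity), Real.log_one,
      Real.log_mul (by positivity) two_ne_zero, Real.log_pow]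
    push_cast
    rw [Real.log_pow]
    ring
  rw [hδ, le_div_iff₀ (by positivity)]
  linarith

theorem theorem1p3 :
    ∃ Ω : Set (EuclideanSpace ℝ (Fin 2)),
      Ω ⊆ Metric.sphere (0 : EuclideanSpace ℝ (Fin 2)) 1 ∧ Ω.Countable ∧
      ∀ t : ℝ, 0 < t → t ≤ 2 →
        ∀ E : Set (EuclideanSpace ℝ (Fin 2)),
          E ⊆ {x | ∀ i, x i ∈ Set.Ico (0 : ℝ) 1} →
          E.Nontrivial →
          IsADRegularSet t E →
          (⨆ e ∈ Ω, upperBoxDim (lineProj e '' E)) = ((min t 1 : ℝ) : EReal) := by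
  -- All `m` are needed, since the required `m` depends on `σ`, `t` and the regularity constant of
  -- `E`.
  refine ⟨Set.range fun p : ℕ × ℕ => slopeDir ((p.2 : ℝ) / (2 ^ p.1 : ℕ)), ?_,
    Set.countable_range _, fun t ht ht2 E hE hnt hreg => ?_⟩
  · rintro _ ⟨p, rfl⟩
    simp [norm_slopeDir]
  obtain ⟨K, ν, h⟩ := hreg.exists_isRegularProbability ht hE hnt
  refine le_antisymm (iSup₂_le ?_) ?_
  · rintro _ ⟨p, rfl⟩
    rcases min_choice t 1 with h1 | h1 <;> rw [h1]
    · exact h.upperBoxDim_lineProj_le ht (norm_slopeDir _)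
    · exact upperBoxDim_lineProj_le_one hE (norm_slopeDir _)
  · refine le_of_forall_lt fun a ha => ?_
    obtain ⟨σ, haσ, hσ⟩ := EReal.lt_iff_exists_real_btwn.1 ha
    obtain ⟨m, j, hmj⟩ := h.exists_slope_upperBoxDim_ge ht2 (EReal.coe_lt_coe_iff.1 hσ)
    refine haσ.trans_le (hmj.trans ?_)
    exact le_iSup₂_of_le (slopeDir ((j : ℝ) / (2 ^ m : ℕ))) ⟨(m, j), rfl⟩ le_rfl
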